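/- **Setting.** Let $\mathbf{Graph}$ be the category of small directed (non-reflexive) graphs and $U\colon\mathbf{Cat}\to\mathbf{Graph}$ the forgetful functor from small categories. The monad $M$ of the adjunction (free category) $\dashv U$ preserves pullbacks, hence induces, by applying $M$ to all objects and structure maps, a 2-monad $\overline M$ on the 2-category $\mathsf{Cat}(\mathbf{Graph})$ of internal categories, internal functors and internal natural transformations in $\mathbf{Graph}$. Let $\overline M\text{-}\mathrm{Alg}_s$ be the category of strict $\overline M$-algebras and strict morphisms. Let $\mathbf{DblCat}=\mathsf{Cat}(\mathbf{Cat})$ be the category of internal categories in $\mathbf{Cat}$ (small double categories) and double functors, and let $\overline U\colon\mathbf{DblCat}\to\mathsf{Cat}(\mathbf{Graph})$ be induced by $U$. *The algebra structure.* In the trivial model structure on a 2-category $\mathcal K$, a 1-cell $F\colon A\to B$ is a weak equivalence (respectively fibration) if for every $E\in\mathcal K$ the functor $\mathcal K(E,F)\colon\mathcal K(E,A)\to\mathcal K(E,B)$ is an equivalence of categories (respectively an isofibration). In the model structure on $\overline M\text{-}\mathrm{Alg}_s$ transferred from the trivial model structure on $\mathsf{Cat}(\mathbf{Graph})$, a strict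 morphism is a weak equivalence (respectively fibration) if and only if its underlying internal functor in $\mathsf{Cat}(\mathbf{Graph})$ is one in the trivial structure; the cofibrations are the morphisms with the left lifting property with respect to all acyclic fibrations. *The $\tau'$-structure.* Let $\tau'$ be the Grothendieck topology on $\mathbf{Cat}$ in which a sieve covers if and only if it contains a categorically surjective functor, i.e. one that is surjective on objects and full. A functor $p$ is a *$\tau'$-epimorphism* if its image under the Yoneda embedding followed by $\tau'$-sheafification is an epimorphism of sheaves. For an internal category $\mathbb B$ in $\mathbf{Cat}$, with object of objects $\mathbb B_0$, object of arrows $\mathbb B_1$ and source and target $s,t\colon\mathbb B_1\to\mathbb B_0$, let $\mathrm{iso}(\mathbb B)_1\subseteq\mathbb B_1$ be the object of (horizontally) invertible arrows. For a double functor $G=(G_0,G_1)\colon\mathbb A\to\mathbb B$, let $(P_G)_0$ be the pullback of $t\colon\mathrm{iso}(\mathbb B)_1\to\mathbb B_0$ and $G_0\colon\mathbb A_0\to\mathbb B_0$, let $\overline G_0\colon(P_G)_0\to\mathrm{iso}(\mathbb B)_1$ be the projection, and let $(r_G)_0\colon\mathrm{iso}(\mathbb A)_1\to(P_G)_0$ be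 the functor induced by $G_1\colon\mathrm{iso}(\mathbb A)_1\to\mathrm{iso}(\mathbb B)_1$ and $t\colon\mathrm{iso}(\mathbb A)_1\to\mathbb A_0$. Call $G$ *fully faithful* if $$\begin{array}{ccc}\mathbb A_1&\xrightarrow{\;G_1\;}&\mathbb B_1\\ {\scriptstyle(s,t)}\downarrow&&\downarrow{\scriptstyle(s,t)}\\ \mathbb A_0\times\mathbb A_0&\xrightarrow{G_0\times G_0}&\mathbb B_0\times\mathbb B_0\end{array}$$ is a pullback square. In the $\tau'$-model structure on $\mathbf{DblCat}$, $G$ is a weak equivalence if it is fully faithful and $s\circ\overline G_0\colon(P_G)_0\to\mathbb B_0$ is a $\tau'$-epimorphism; $G$ is a fibration if $(r_G)_0$ is a $\tau'$-epimorphism; and $G$ is a cofibration if it has the left lifting property with respect to all acyclic fibrations. **Theorem.** The comparison functor $\mathbf{DblCat}\to\overline M\text{-}\mathrm{Alg}_s$, which sends a double category $\mathbb D$ to $\overline U\mathbb D$ with the $\overline M$-action given by vertical composition, is an equivalence of categories. Under it the model structure on $\overline M\text{-}\mathrm{Alg}_s$ transferred from the trivial model structure on $\mathsf{Cat}(\mathbf{Graph})$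 coincides with the $\tau'$-model structure on $\mathbf{DblCat}$: a double functor is a weak equivalence (respectively a fibration, a cofibration) in one if and only if it is so in the other. Moreover, call a functor $p\colon E\to B$ *$U$-split* if the graph morphism $Up$ has a section, i.e. $Up\circ q=\mathrm{id}_{UB}$ for some graph morphism $q\colon UB\to UE$. Then a double functor $G$ is a weak equivalence in this model structure if and only if it is fully faithful and $s\circ\overline G_0$ is $U$-split, and it is a fibration if and only if $(r_G)_0$ is $U$-split. -/

import Mathlib

open CategoryTheory CategoryTheory.Limits

universe v v' u u'

/-- An internal category in `C`: objects `obj`, arrows `arr`, a chosen pullback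
`pairs` of composable pairs `(x, y)` with `tgt x = src y`, and composition `mul`
(in diagrammatic order). -/
structure InternalCat (C : Type u) [Category.{v} C] where
  obj : C
  arr : C
  pairs : C
  src : arr ⟶ obj
  tgt : arr ⟶ obj
  unit : obj ⟶ arr
  fst : pairs ⟶ arr
  snd : pairs ⟶ arr
  isPullback : IsPullback fst snd tgt src
  mul : pairs ⟶ arr
  unit_src : unit ≫ src = 𝟙 obj
  unit_tgt : unit ≫ tgt = 𝟙 obj
  mul_src : mul ≫ src = fst ≫ src
  mul_tgt : mul ≫ tgt = snd ≫ tgt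
  unit_mul : isPullback.lift (src ≫ unit) (𝟙 arr)
    (by rw [Category.assoc, unit_tgt, Category.comp_id, Category.id_comp]) ≫ mul = 𝟙 arr
  mul_unit : isPullback.lift (𝟙 arr) (tgt ≫ unit)
    (by rw [Category.assoc, unit_src, Category.comp_id, Category.id_comp]) ≫ mul = 𝟙 arr
  /-- Associativity, on generalised composable triples. -/
  mul_assoc : ∀ {X : C} (x y z : X ⟶ arr) (hxy : x ≫ tgt = y ≫ src) (hyz : y ≫ tgt = z ≫ src),
    isPullback.lift (isPullback.lift x y hxy ≫ mul) z
        (by rw [Category.assoc, mul_tgt, IsPullback.lift_snd_assoc, hyz]) ≫ mul =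
      isPullback.lift x (isPullback.lift y z hyz ≫ mul)
        (by rw [Category.assoc, mul_src, IsPullback.lift_fst_assoc, hxy]) ≫ mul

namespace InternalCat

variable {C : Type u} [Category.{v} C]

noncomputable section

/-- The composite of two composable generalised arrows. -/
def hcomp (B : InternalCat C) {X : C} (x y : X ⟶ B.arr) (h : x ≫ B.tgt = y ≫ B.src) :
    X ⟶ B.arr :=
  B.isPullback.lift x y h ≫ B.mul

section hcomp

variable (B : InternalCat C) {X Y : C}

attribute [simp] unit_src unit_tgt

@[simp]
lemma unit_src_assoc (f : B.obj ⟶ X) : B.unit ≫ B.src ≫ f = f := by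
  rw [← Category.assoc, unit_src, Category.id_comp]

@[simp]
lemma unit_tgt_assoc (f : B.obj ⟶ X) : B.unit ≫ B.tgt ≫ f = f := by
  rw [← Category.assoc, unit_tgt, Category.id_comp]

@[simp]
lemma hcomp_src (x y : X ⟶ B.arr) (h : x ≫ B.tgt = y ≫ B.src) :
    B.hcomp x y h ≫ B.src = x ≫ B.src := by
  simp [hcomp, mul_src]

@[simp]
lemma hcomp_tgt (x y : X ⟶ B.arr) (h : x ≫ B.tgt = y ≫ B.src) :
    B.hcomp x y h ≫ B.tgt = y ≫ B.tgt := by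
  simp [hcomp, mul_tgt]

lemma comp_hcomp (k : Y ⟶ X) (x y : X ⟶ B.arr) (h : x ≫ B.tgt = y ≫ B.src) :
    k ≫ B.hcomp x y h = B.hcomp (k ≫ x) (k ≫ y) (by simp [h]) := by
  rw [hcomp, hcomp, ← Category.assoc]
  congr 1
  apply B.isPullback.hom_ext <;> simp

@[simp]
lemma unit_hcomp (a : X ⟶ B.obj) (x : X ⟶ B.arr) (h : (a ≫ B.unit) ≫ B.tgt = x ≫ B.src) :
    B.hcomp (a ≫ B.unit) x h = x := by
  have ha : a = x ≫ B.src := by simpa using h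
  subst ha
  refine Eq.trans ?_ ((congrArg (fun t => x ≫ t) B.unit_mul).trans (Category.comp_id x))
  rw [hcomp, ← Category.assoc x]
  congr 1
  apply B.isPullback.hom_ext <;> simp

@[simp]
lemma hcomp_unit (a : X ⟶ B.obj) (x : X ⟶ B.arr) (h : x ≫ B.tgt = (a ≫ B.unit) ≫ B.src) :
    B.hcomp x (a ≫ B.unit) h = x := by
  have ha : a = x ≫ B.tgt := by simpa using h.symm
  subst ha
  refine Eq.trans ?_ ((congrArg (fun t => x ≫ t) B.mul_unit).trans (Category.comp_id x))
  rw [hcomp, ← Category.assoc x]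
  congr 1
  apply B.isPullback.hom_ext <;> simp

lemma hcomp_assoc (x y z : X ⟶ B.arr) (hxy : x ≫ B.tgt = y ≫ B.src)
    (hyz : y ≫ B.tgt = z ≫ B.src) :
    B.hcomp (B.hcomp x y hxy) z (by simp [hyz]) =
      B.hcomp x (B.hcomp y z hyz) (by simp [hxy]) :=
  B.mul_assoc x y z hxy hyz

end hcomp

/-- Internal functors. -/
@[ext]
structure Hom (A B : InternalCat C) where
  obj : A.obj ⟶ B.obj
  arr : A.arr ⟶ B.arr
  arr_src : arr ≫ B.src = A.src ≫ obj
  arr_tgt : arr ≫ B.tgt = A.tgt ≫ obj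
  unit_arr : A.unit ≫ arr = obj ≫ B.unit
  mul_arr : A.mul ≫ arr = B.hcomp (A.fst ≫ arr) (A.snd ≫ arr)
    (by rw [Category.assoc, Category.assoc, arr_tgt, arr_src, ← Category.assoc,
      ← Category.assoc, A.isPullback.w])

attribute [simp] Hom.arr_src Hom.arr_tgt Hom.unit_arr

section

variable {A B : InternalCat C} {X : C}

@[simp]
lemma Hom.arr_src_assoc (F : Hom A B) (f : B.obj ⟶ X) :
    F.arr ≫ B.src ≫ f = A.src ≫ F.obj ≫ f := by
  rw [← Category.assoc, F.arr_src, Category.assoc]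

@[simp]
lemma Hom.arr_tgt_assoc (F : Hom A B) (f : B.obj ⟶ X) :
    F.arr ≫ B.tgt ≫ f = A.tgt ≫ F.obj ≫ f := by
  rw [← Category.assoc, F.arr_tgt, Category.assoc]

@[simp]
lemma Hom.unit_arr_assoc (F : Hom A B) (f : B.arr ⟶ X) :
    A.unit ≫ F.arr ≫ f = F.obj ≫ B.unit ≫ f := by
  rw [← Category.assoc, F.unit_arr, Category.assoc]

end

lemma Hom.hcomp_arr {A B : InternalCat C} (F : Hom A B) {X : C} (x y : X ⟶ A.arr)
    (h : x ≫ A.tgt = y ≫ A.src) :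
    A.hcomp x y h ≫ F.arr = B.hcomp (x ≫ F.arr) (y ≫ F.arr)
      (by rw [Category.assoc, Category.assoc, F.arr_tgt, F.arr_src, ← Category.assoc, h,
        Category.assoc]) := by
  rw [hcomp, Category.assoc, F.mul_arr, comp_hcomp]
  simp

/-- The category of internal categories and internal functors in `C`. -/
instance : Category (InternalCat C) where
  Hom := Hom
  id A :=
    { obj := 𝟙 _
      arr := 𝟙 _
      arr_src := by simp
      arr_tgt := by simp
      unit_arr := by simp
      mul_arr := by
        have : A.isPullback.lift A.fst A.snd A.isPullback.w = 𝟙 _ := by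
          apply A.isPullback.hom_ext <;> simp
        simp [hcomp, this] }
  comp {A B D} F G :=
    { obj := F.obj ≫ G.obj
      arr := F.arr ≫ G.arr
      arr_src := by simp
      arr_tgt := by simp
      unit_arr := by simp
      mul_arr := by
        rw [← Category.assoc, F.mul_arr, G.hcomp_arr]
        simp }

@[simp] lemma id_obj (A : InternalCat C) : Hom.obj (𝟙 A) = 𝟙 A.obj := rfl
@[simp] lemma id_arr (A : InternalCat C) : Hom.arr (𝟙 A) = 𝟙 A.arr := rfl

section

variable {A B D : InternalCat C}

@[simp] lemma comp_obj (F : A ⟶ B) (G : B ⟶ D) : (F ≫ G).obj = F.obj ≫ G.obj := rfl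
@[simp] lemma comp_arr (F : A ⟶ B) (G : B ⟶ D) : (F ≫ G).arr = F.arr ≫ G.arr := rfl

@[ext]
lemma hom_ext {F G : A ⟶ B} (h₀ : F.obj = G.obj) (h₁ : F.arr = G.arr) : F = G :=
  Hom.ext h₀ h₁

/-- Internal natural transformations: the 2-cells of the 2-category of internal categories. -/
@[ext]
structure Cell (F G : A ⟶ B) where
  app : A.obj ⟶ B.arr
  app_src : app ≫ B.src = F.obj
  app_tgt : app ≫ B.tgt = G.obj
  naturality : B.hcomp F.arr (A.tgt ≫ app) (by simp [app_src]) =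
    B.hcomp (A.src ≫ app) G.arr (by simp [app_tgt])

attribute [simp] Cell.app_src Cell.app_tgt

@[simp]
lemma Cell.app_src_assoc {F G : A ⟶ B} (α : Cell F G) {X : C} (f : B.obj ⟶ X) :
    α.app ≫ B.src ≫ f = F.obj ≫ f := by
  rw [← Category.assoc, α.app_src]

@[simp]
lemma Cell.app_tgt_assoc {F G : A ⟶ B} (α : Cell F G) {X : C} (f : B.obj ⟶ X) :
    α.app ≫ B.tgt ≫ f = G.obj ≫ f := by
  rw [← Category.assoc, α.app_tgt]

/-- The category of internal functors `A ⟶ B` and internal natural transformations. -/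
instance homCategory (A B : InternalCat C) : Category (A ⟶ B) where
  Hom := Cell
  id F :=
    { app := F.obj ≫ B.unit
      app_src := by simp
      app_tgt := by simp
      naturality := by
        simp only [← Category.assoc, hcomp_unit, unit_hcomp] }
  comp {F G H} α β :=
    { app := B.hcomp α.app β.app (by simp)
      app_src := by simp
      app_tgt := by simp
      naturality := by
        simp only [comp_hcomp]
        rw [← hcomp_assoc _ _ _ _ (by simp) (by simp)]
        simp only [α.naturality]
        rw [hcomp_assoc _ _ _ _ (by simp) (by simp)]
        simp only [β.naturality]
        rw [hcomp_assoc _ _ _ _ (by simp) (by simp)] }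
  id_comp α := by ext; simp
  comp_id α := by ext; simp
  assoc α β γ := by
    ext
    exact hcomp_assoc _ _ _ _ _ _

@[simp] lemma cell_id_app (F : A ⟶ B) : Cell.app (𝟙 F) = F.obj ≫ B.unit := rfl
@[simp] lemma cell_comp_app {F G H : A ⟶ B} (α : F ⟶ G) (β : G ⟶ H) :
    Cell.app (α ≫ β) = B.hcomp α.app β.app (by simp) := rfl

@[ext]
lemma cell_ext {F G : A ⟶ B} {α β : F ⟶ G} (h : Cell.app α = Cell.app β) : α = β :=
  Cell.ext h

/-- Post-composition with `F`, as a functor between categories of internal functors. -/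
def postcomp (E : InternalCat C) (F : A ⟶ B) : (E ⟶ A) ⥤ (E ⟶ B) where
  obj a := a ≫ F
  map {a b} α :=
    { app := Cell.app α ≫ F.arr
      app_src := by simp
      app_tgt := by simp
      naturality := by
        have := congrArg (fun t => t ≫ F.arr) (Cell.naturality α)
        simpa only [Hom.hcomp_arr, Category.assoc, comp_arr] using this }
  map_id a := by ext; simp
  map_comp α β := by
    ext
    exact Hom.hcomp_arr _ _ _ _

@[simp]
lemma postcomp_obj (E : InternalCat C) (F : A ⟶ B) (a : E ⟶ A) :
    (postcomp E F).obj a = a ≫ F := rfl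

@[simp]
lemma postcomp_map_app (E : InternalCat C) (F : A ⟶ B) {a b : E ⟶ A} (α : a ⟶ b) :
    Cell.app ((postcomp E F).map α) = Cell.app α ≫ F.arr := rfl

end


/-! ### The trivial model structure on the 2-category of internal categories -/

/-- A functor is an isofibration if isomorphisms `b ≅ F e` lift to isomorphisms `b' ≅ e`. -/
def IsIsofibration {X : Type*} {Y : Type*} [Category X] [Category Y] (F : X ⥤ Y) : Prop :=
  ∀ (e : X) (b : Y) (β : b ≅ F.obj e), ∃ (b' : X) (α : b' ≅ e) (h : F.obj b' = b),
    F.map α.hom = eqToHom h ≫ β.hom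

/-- Weak equivalences of the trivial model structure: `K(E, F)` is an equivalence of
categories for all `E`. -/
def trivialWE : MorphismProperty (InternalCat C) :=
  fun _ _ F => ∀ E : InternalCat C, (postcomp E F).IsEquivalence

/-- Fibrations of the trivial model structure: `K(E, F)` is an isofibration for all `E`. -/
def trivialFib : MorphismProperty (InternalCat C) :=
  fun _ _ F => ∀ E : InternalCat C, IsIsofibration (postcomp E F)

/-! ### Functoriality of internal categories in pullback-preserving functors -/

section map

variable {D : Type u'} [Category.{v'} D] [HasPullbacks C]

/-- The internal category in `D` obtained by applying a pullback-preserving functor. -/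
def mapObj (F : C ⥤ D) [PreservesLimitsOfShape WalkingCospan F] (A : InternalCat C) :
    InternalCat D where
  obj := F.obj A.obj
  arr := F.obj A.arr
  pairs := F.obj A.pairs
  src := F.map A.src
  tgt := F.map A.tgt
  unit := F.map A.unit
  fst := F.map A.fst
  snd := F.map A.snd
  isPullback := A.isPullback.map F
  mul := F.map A.mul
  unit_src := by rw [← F.map_comp, A.unit_src, F.map_id]
  unit_tgt := by rw [← F.map_comp, A.unit_tgt, F.map_id]
  mul_src := by rw [← F.map_comp, A.mul_src, F.map_comp]
  mul_tgt := by rw [← F.map_comp, A.mul_tgt, F.map_comp]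
  unit_mul := by
    refine Eq.trans ?_ ((congrArg (fun t => F.map t) A.unit_mul).trans (F.map_id _))
    refine Eq.trans ?_ (F.map_comp _ _).symm
    refine congrArg (fun t => t ≫ F.map A.mul) ?_
    apply (A.isPullback.map F).hom_ext
    · rw [IsPullback.lift_fst, ← F.map_comp, ← F.map_comp, IsPullback.lift_fst]
    · rw [IsPullback.lift_snd, ← F.map_comp, IsPullback.lift_snd, F.map_id]
  mul_unit := by
    refine Eq.trans ?_ ((congrArg (fun t => F.map t) A.mul_unit).trans (F.map_id _))
    refine Eq.trans ?_ (F.map_comp _ _).symm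
    refine congrArg (fun t => t ≫ F.map A.mul) ?_
    apply (A.isPullback.map F).hom_ext
    · rw [IsPullback.lift_fst, ← F.map_comp, IsPullback.lift_fst, F.map_id]
    · rw [IsPullback.lift_snd, ← F.map_comp, ← F.map_comp, IsPullback.lift_snd]
  mul_assoc {X} x y z hxy hyz := by
    have hT := (IsPullback.of_hasPullback A.snd A.fst).map F
    let p := (A.isPullback.map F).lift x y hxy
    let q := (A.isPullback.map F).lift y z hyz
    let w : X ⟶ F.obj (pullback A.snd A.fst) := hT.lift p q (by simp [p, q])
    have hw₁ : w ≫ F.map (pullback.fst A.snd A.fst) = p := hT.lift_fst _ _ _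
    have hw₂ : w ≫ F.map (pullback.snd A.snd A.fst) = q := hT.lift_snd _ _ _
    have h₁ : (pullback.fst A.snd A.fst ≫ A.fst) ≫ A.tgt =
        (pullback.fst A.snd A.fst ≫ A.snd) ≫ A.src := by
      rw [Category.assoc, Category.assoc, A.isPullback.w]
    have h₂ : (pullback.fst A.snd A.fst ≫ A.snd) ≫ A.tgt =
        (pullback.snd A.snd A.fst ≫ A.snd) ≫ A.src := by
      rw [pullback.condition, Category.assoc, Category.assoc, A.isPullback.w]
    have h := A.mul_assoc (X := pullback A.snd A.fst)
      (pullback.fst _ _ ≫ A.fst) (pullback.fst _ _ ≫ A.snd) (pullback.snd _ _ ≫ A.snd) h₁ h₂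
    have hx : x = w ≫ F.map (pullback.fst _ _ ≫ A.fst) := by
      rw [F.map_comp, ← Category.assoc, hw₁]; simp [p]
    have hy : y = w ≫ F.map (pullback.fst _ _ ≫ A.snd) := by
      rw [F.map_comp, ← Category.assoc, hw₁]; simp [p]
    have hz : z = w ≫ F.map (pullback.snd _ _ ≫ A.snd) := by
      rw [F.map_comp, ← Category.assoc, hw₂]; simp [q]
    have key : ∀ (a b : pullback A.snd A.fst ⟶ A.arr) (hab : a ≫ A.tgt = b ≫ A.src)
        (a' b' : X ⟶ F.obj A.arr) (ha : a' = w ≫ F.map a) (hb : b' = w ≫ F.map b)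
        (hab' : a' ≫ F.map A.tgt = b' ≫ F.map A.src),
        (A.isPullback.map F).lift a' b' hab' ≫ F.map A.mul =
          w ≫ F.map (A.isPullback.lift a b hab ≫ A.mul) := by
      intro a b hab a' b' ha hb hab'
      rw [F.map_comp, ← Category.assoc w]
      congr 1
      apply (A.isPullback.map F).hom_ext
      · rw [IsPullback.lift_fst, Category.assoc, ← F.map_comp, IsPullback.lift_fst, ha]
      · rw [IsPullback.lift_snd, Category.assoc, ← F.map_comp, IsPullback.lift_snd, hb]
    rw [key _ _ (by rw [Category.assoc, A.mul_tgt, IsPullback.lift_snd_assoc, h₂]) _ _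
        (key _ _ h₁ _ _ hx hy _) hz _,
      key _ _ (by rw [Category.assoc _ A.mul, A.mul_src, IsPullback.lift_fst_assoc, h₁]) _ _ hx
        (key _ _ h₂ _ _ hy hz _) _, h]

lemma mapObj_hcomp (F : C ⥤ D) [PreservesLimitsOfShape WalkingCospan F] (A : InternalCat C)
    {X : C} (x y : X ⟶ A.arr) (h : x ≫ A.tgt = y ≫ A.src) :
    F.map (A.hcomp x y h) = (A.mapObj F).hcomp (F.map x) (F.map y)
      (by simp only [mapObj, ← F.map_comp, h]) := by
  refine (F.map_comp _ _).trans (congrArg (fun t => t ≫ F.map A.mul) ?_)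
  apply (A.isPullback.map F).hom_ext
  · exact ((F.map_comp _ _).symm.trans (congrArg (fun t => F.map t)
      (IsPullback.lift_fst _ _ _ _))).trans (IsPullback.lift_fst _ _ _ _).symm
  · exact ((F.map_comp _ _).symm.trans (congrArg (fun t => F.map t)
      (IsPullback.lift_snd _ _ _ _))).trans (IsPullback.lift_snd _ _ _ _).symm

/-- The functor between categories of internal categories induced by a pullback-preserving
functor. -/
def map (F : C ⥤ D) [PreservesLimitsOfShape WalkingCospan F] : InternalCat C ⥤ InternalCat D where
  obj A := A.mapObj F
  map {A B} G :=
    { obj := F.map G.obj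
      arr := F.map G.arr
      arr_src := by simp only [mapObj, ← F.map_comp, G.arr_src]
      arr_tgt := by simp only [mapObj, ← F.map_comp, G.arr_tgt]
      unit_arr := by simp only [mapObj, ← F.map_comp, G.unit_arr]
      mul_arr := by
        refine ((F.map_comp _ _).symm.trans (congrArg (fun t => F.map t) G.mul_arr)).trans ?_
        rw [mapObj_hcomp]
        simp only [F.map_comp]
        rfl }
  map_id A := hom_ext (F.map_id _) (F.map_id _)
  map_comp G H := hom_ext (F.map_comp _ _) (F.map_comp _ _)

/-- The action of `map F` on 2-cells, as functors between categories of internal functors. -/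
def mapHom (F : C ⥤ D) [PreservesLimitsOfShape WalkingCospan F] (A B : InternalCat C) :
    (A ⟶ B) ⥤ ((map F).obj A ⟶ (map F).obj B) where
  obj G := (map F).map G
  map {G H} α :=
    { app := F.map (Cell.app α)
      app_src := by simp only [map, mapObj, ← F.map_comp, Cell.app_src]
      app_tgt := by simp only [map, mapObj, ← F.map_comp, Cell.app_tgt]
      naturality := by
        have h := congrArg (fun t => F.map t) (Cell.naturality α)
        simp only [mapObj_hcomp, F.map_comp] at h
        exact h }
  map_id G := by
    ext
    exact F.map_comp _ _
  map_comp α β := by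
    ext
    exact mapObj_hcomp F B _ _ _

/-- The natural transformation `map F ⟶ map G` induced by `F ⟶ G`. -/
def mapNat {F G : C ⥤ D} [PreservesLimitsOfShape WalkingCospan F]
    [PreservesLimitsOfShape WalkingCospan G] (α : F ⟶ G) : map (C := C) F ⟶ map G where
  app A :=
    { obj := α.app A.obj
      arr := α.app A.arr
      arr_src := (α.naturality _).symm
      arr_tgt := (α.naturality _).symm
      unit_arr := α.naturality _
      mul_arr := by
        refine (α.naturality A.mul).trans ?_
        refine congrArg (fun t => t ≫ G.map A.mul) ?_
        apply (A.isPullback.map G).hom_ext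
        · exact (α.naturality A.fst).symm.trans (IsPullback.lift_fst _ _ _ _).symm
        · exact (α.naturality A.snd).symm.trans (IsPullback.lift_snd _ _ _ _).symm }
  naturality A B K := hom_ext (α.naturality _) (α.naturality _)

/-- A pullback-preserving monad on `C` induces a 2-monad on internal categories in `C`. This is its
underlying monad, which determines the strict algebras and strict morphisms; the action on 2-cells
is `mapHom`, and the unit and multiplication are 2-natural by the two lemmas below. -/
def mapMonad (T : Monad C) [PreservesLimitsOfShape WalkingCospan T.toFunctor] :
    Monad (InternalCat C) where
  toFunctor := map T.toFunctor
  η := { app := fun A => (mapNat (F := 𝟭 C) T.η).app A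
         naturality := fun _ _ _ => hom_ext (T.η.naturality _) (T.η.naturality _) }
  μ := { app := fun A => (mapNat (F := T.toFunctor ⋙ T.toFunctor) T.μ).app A
         naturality := fun _ _ _ => hom_ext (T.μ.naturality _) (T.μ.naturality _) }
  assoc _ := hom_ext (T.assoc _) (T.assoc _)
  left_unit _ := hom_ext (T.left_unit _) (T.left_unit _)
  right_unit _ := hom_ext (T.right_unit _) (T.right_unit _)

/-- The unit of the induced monad is natural with respect to 2-cells. -/
lemma mapMonad_η_cell (T : Monad C) [PreservesLimitsOfShape WalkingCospan T.toFunctor]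
    {A B : InternalCat C} {F G : A ⟶ B} (α : F ⟶ G) :
    Cell.app α ≫ ((mapMonad T).η.app B).arr =
      ((mapMonad T).η.app A).obj ≫ Cell.app ((mapHom T.toFunctor A B).map α) :=
  T.η.naturality (Cell.app α)

/-- The multiplication of the induced monad is natural with respect to 2-cells. -/
lemma mapMonad_μ_cell (T : Monad C) [PreservesLimitsOfShape WalkingCospan T.toFunctor]
    {A B : InternalCat C} {F G : A ⟶ B} (α : F ⟶ G) :
    T.map (T.map (Cell.app α)) ≫ ((mapMonad T).μ.app B).arr =
      ((mapMonad T).μ.app A).obj ≫ Cell.app ((mapHom T.toFunctor A B).map α) :=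
  T.μ.naturality (Cell.app α)

end map

/-! ### The comparison functor of an adjunction -/

section comparison

variable {D : Type u'} [Category.{v'} D] [HasPullbacks C] [HasPullbacks D]

/-- For an adjunction `L ⊣ R` with monad `T`, such that `T` and `R` preserve pullbacks, an
internal category `A` in `D` is sent to `R A` with its `T`-algebra structure `R L R A ⟶ R A` given
by the counit. -/
def comparison {L : C ⥤ D} {R : D ⥤ C} (adj : L ⊣ R)
    [PreservesLimitsOfShape WalkingCospan R]
    [PreservesLimitsOfShape WalkingCospan adj.toMonad.toFunctor] :
    InternalCat D ⥤ (mapMonad adj.toMonad).Algebra where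
  obj A :=
    { A := (map R).obj A
      a :=
        { obj := R.map (adj.counit.app A.obj)
          arr := R.map (adj.counit.app A.arr)
          arr_src := ((Functor.whiskerRight adj.counit R).naturality A.src).symm
          arr_tgt := ((Functor.whiskerRight adj.counit R).naturality A.tgt).symm
          unit_arr := (Functor.whiskerRight adj.counit R).naturality A.unit
          mul_arr := by
            refine ((Functor.whiskerRight adj.counit R).naturality A.mul).trans ?_
            refine congrArg (fun t => t ≫ R.map A.mul) ?_
            apply (A.isPullback.map R).hom_ext
            · exact ((Functor.whiskerRight adj.counit R).naturality A.fst).symm.trans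
                (IsPullback.lift_fst _ _ _ _).symm
            · exact ((Functor.whiskerRight adj.counit R).naturality A.snd).symm.trans
                (IsPullback.lift_snd _ _ _ _).symm }
      unit := hom_ext ((Monad.comparison adj).obj A.obj).unit ((Monad.comparison adj).obj A.arr).unit
      assoc := hom_ext ((Monad.comparison adj).obj A.obj).assoc
        ((Monad.comparison adj).obj A.arr).assoc }
  map F :=
    { f := (map R).map F
      h := hom_ext ((Monad.comparison adj).map F.obj).h ((Monad.comparison adj).map F.arr).h }
  map_id A := Monad.Algebra.Hom.ext ((map R).map_id A)
  map_comp F G := Monad.Algebra.Hom.ext ((map R).map_comp F G)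

end comparison

/-! ### Internal equivalences and fibrations relative to a Grothendieck topology -/

section topology

/-- A generalised arrow is invertible if it has a two-sided inverse for the composition of `B`. -/
def IsInverse (B : InternalCat C) {X : C} (x y : X ⟶ B.arr) : Prop :=
  ∃ (h : x ≫ B.tgt = y ≫ B.src) (h' : y ≫ B.tgt = x ≫ B.src),
    B.hcomp x y h = x ≫ B.src ≫ B.unit ∧ B.hcomp y x h' = y ≫ B.src ≫ B.unit

lemma IsInverse.comp_arr {A B : InternalCat C} (F : A ⟶ B) {X : C} {x y : X ⟶ A.arr}
    (h : A.IsInverse x y) : B.IsInverse (x ≫ F.arr) (y ≫ F.arr) := by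
  obtain ⟨h₁, h₂, h₃, h₄⟩ := h
  refine ⟨?_, ?_, ?_, ?_⟩
  · rw [Category.assoc, Category.assoc, Hom.arr_tgt, Hom.arr_src, ← Category.assoc, h₁,
      Category.assoc]
  · rw [Category.assoc, Category.assoc, Hom.arr_tgt, Hom.arr_src, ← Category.assoc, h₂,
      Category.assoc]
  · rw [← Hom.hcomp_arr F _ _ h₁, h₃]
    simp
  · rw [← Hom.hcomp_arr F _ _ h₂, h₄]
    simp

/-- An arrow has at most one inverse. -/
lemma IsInverse.unique {B : InternalCat C} {X : C} {x y z : X ⟶ B.arr} (h : B.IsInverse x y)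
    (h' : B.IsInverse x z) : y = z := by
  obtain ⟨h₁, h₂, -, h₄⟩ := h
  obtain ⟨k₁, k₂, k₃, -⟩ := h'
  have e := B.hcomp_assoc y x z h₂ k₁
  simp only [h₄, k₃] at e
  have hy : y ≫ B.tgt ≫ B.unit = x ≫ B.src ≫ B.unit := by
    rw [← Category.assoc, h₂, Category.assoc]
  have hz : z ≫ B.src ≫ B.unit = y ≫ B.src ≫ B.unit := by
    rw [← Category.assoc, ← k₁, h₁, Category.assoc]
  simp only [← hy, ← hz, ← Category.assoc, unit_hcomp, hcomp_unit] at e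
  exact e.symm

lemma IsInverse.precomp {B : InternalCat C} {X Y : C} {x y : X ⟶ B.arr} (k : Y ⟶ X)
    (h : B.IsInverse x y) : B.IsInverse (k ≫ x) (k ≫ y) := by
  obtain ⟨h₁, h₂, h₃, h₄⟩ := h
  refine ⟨by rw [Category.assoc, h₁, Category.assoc], by rw [Category.assoc, h₂, Category.assoc],
    ?_, ?_⟩
  · rw [← comp_hcomp _ _ _ _ h₁, h₃, Category.assoc]
  · rw [← comp_hcomp _ _ _ _ h₂, h₄, Category.assoc]

variable [HasFiniteLimits C]

/-- The object of composable pairs `(x, y)` such that `xy` is an identity. -/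
def splitPairs (B : InternalCat C) : C := pullback B.mul B.unit

/-- The underlying composable pair. -/
def splitPair (B : InternalCat C) : B.splitPairs ⟶ B.pairs := pullback.fst B.mul B.unit

/-- The object at which the composite of `(x, y)` is the identity. -/
def splitObj (B : InternalCat C) : B.splitPairs ⟶ B.obj := pullback.snd B.mul B.unit

/-- `(x, y) ↦ x`. -/
def splitFst (B : InternalCat C) : B.splitPairs ⟶ B.arr := B.splitPair ≫ B.fst

/-- `(x, y) ↦ y`. -/
def splitSnd (B : InternalCat C) : B.splitPairs ⟶ B.arr := B.splitPair ≫ B.snd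

/-- The object `iso(B)₁` of invertible arrows of `B`: it classifies pairs of mutually inverse
arrows, that is, two composable pairs `(x, y)` and `(y', x')` whose composites are identities and
such that `x = x'` and `y = y'`. -/
def isoArr (B : InternalCat C) : C :=
  pullback (prod.lift B.splitFst B.splitSnd) (prod.lift B.splitSnd B.splitFst)

/-- The composable pair `(x, y)` on `iso(B)₁`. -/
def isoPair (B : InternalCat C) : B.isoArr ⟶ B.splitPairs := pullback.fst _ _

/-- The composable pair `(y, x)` on `iso(B)₁`. -/
def isoPair' (B : InternalCat C) : B.isoArr ⟶ B.splitPairs := pullback.snd _ _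

/-- The inclusion of `iso(B)₁` in `B₁`. -/
def isoι (B : InternalCat C) : B.isoArr ⟶ B.arr := B.isoPair ≫ B.splitFst

/-- The inverse of the generic invertible arrow. -/
def isoInv (B : InternalCat C) : B.isoArr ⟶ B.arr := B.isoPair ≫ B.splitSnd

lemma exists_splitLift (B : InternalCat C) {X : C} {x y : X ⟶ B.arr}
    (h : x ≫ B.tgt = y ≫ B.src) (hxy : B.hcomp x y h = x ≫ B.src ≫ B.unit) :
    ∃ k : X ⟶ B.splitPairs, k ≫ B.splitFst = x ∧ k ≫ B.splitSnd = y := by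
  refine ⟨pullback.lift (B.isPullback.lift x y h) (x ≫ B.src) ?_, ?_, ?_⟩
  · rw [Category.assoc]
    exact hxy
  · exact (pullback.lift_fst_assoc _ _ _ _).trans (IsPullback.lift_fst _ _ _ _)
  · exact (pullback.lift_fst_assoc _ _ _ _).trans (IsPullback.lift_snd _ _ _ _)

lemma split_w (B : InternalCat C) : B.splitFst ≫ B.tgt = B.splitSnd ≫ B.src := by
  rw [splitFst, splitSnd, Category.assoc, Category.assoc, B.isPullback.w]

lemma splitPair_mul (B : InternalCat C) :
    B.splitPair ≫ B.mul = B.splitFst ≫ B.src ≫ B.unit := by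
  have h₂ : B.splitPair ≫ B.mul = B.splitObj ≫ B.unit := pullback.condition
  have h₃ := congrArg (fun t => t ≫ B.src) h₂
  simp only [Category.assoc, B.mul_src, B.unit_src, Category.comp_id] at h₃
  rw [h₂, ← h₃, splitFst]
  simp only [Category.assoc]

lemma split_hcomp (B : InternalCat C) :
    B.hcomp B.splitFst B.splitSnd B.split_w = B.splitFst ≫ B.src ≫ B.unit := by
  rw [← splitPair_mul]
  refine congrArg (fun t => t ≫ B.mul) ?_
  apply B.isPullback.hom_ext
  · exact IsPullback.lift_fst _ _ _ _
  · exact IsPullback.lift_snd _ _ _ _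

lemma split_ext (B : InternalCat C) {X : C} {k l : X ⟶ B.splitPairs}
    (h₁ : k ≫ B.splitFst = l ≫ B.splitFst) (h₂ : k ≫ B.splitSnd = l ≫ B.splitSnd) : k = l := by
  have h₃ : k ≫ B.splitPair = l ≫ B.splitPair := by
    apply B.isPullback.hom_ext
    · simpa only [splitFst, Category.assoc] using h₁
    · simpa only [splitSnd, Category.assoc] using h₂
  have hu : Mono B.unit := ⟨fun f g h => by
    have := congrArg (fun t => t ≫ B.src) h
    simpa using this⟩
  have : Mono B.splitPair := inferInstanceAs (Mono (pullback.fst B.mul B.unit))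
  exact (cancel_mono _).1 h₃

/-- The universal property of `iso(B)₁`: existence. -/
lemma exists_isoLift (B : InternalCat C) {X : C} {x y : X ⟶ B.arr} (h : B.IsInverse x y) :
    ∃ k : X ⟶ B.isoArr, k ≫ B.isoι = x ∧ k ≫ B.isoInv = y := by
  obtain ⟨h₁, h₂, h₃, h₄⟩ := h
  obtain ⟨k, hk₁, hk₂⟩ := B.exists_splitLift h₁ h₃
  obtain ⟨l, hl₁, hl₂⟩ := B.exists_splitLift h₂ h₄
  refine ⟨pullback.lift k l ?_, ?_, ?_⟩
  · rw [prod.comp_lift, prod.comp_lift, hk₁, hk₂, hl₁, hl₂]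
  · exact (pullback.lift_fst_assoc _ _ _ _).trans hk₁
  · exact (pullback.lift_fst_assoc _ _ _ _).trans hk₂

lemma isoPair_condition (B : InternalCat C) :
    B.isoPair ≫ prod.lift B.splitFst B.splitSnd =
      B.isoPair' ≫ prod.lift B.splitSnd B.splitFst := pullback.condition

lemma isoι_eq (B : InternalCat C) : B.isoι = B.isoPair' ≫ B.splitSnd := by
  have h := B.isoPair_condition =≫ prod.fst
  rwa [Category.assoc, Category.assoc, prod.lift_fst, prod.lift_fst] at h

lemma isoInv_eq (B : InternalCat C) : B.isoInv = B.isoPair' ≫ B.splitFst := by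
  have h := B.isoPair_condition =≫ prod.snd
  rwa [Category.assoc, Category.assoc, prod.lift_snd, prod.lift_snd] at h

/-- The two generic arrows on `iso(B)₁` are mutually inverse. -/
lemma isInverse_iso (B : InternalCat C) : B.IsInverse B.isoι B.isoInv := by
  refine ⟨?_, ?_, ?_, ?_⟩
  · rw [isoι, isoInv, Category.assoc, Category.assoc, B.split_w]
  · rw [isoι_eq, isoInv_eq, Category.assoc, Category.assoc, B.split_w]
  · simp only [isoι, isoInv]
    rw [← comp_hcomp _ _ _ _ B.split_w, B.split_hcomp]
    simp only [Category.assoc]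
  · simp only [isoι_eq, isoInv_eq]
    rw [← comp_hcomp _ _ _ _ B.split_w, B.split_hcomp]
    simp only [Category.assoc]

/-- The universal property of `iso(B)₁`: uniqueness. -/
instance (B : InternalCat C) : Mono B.isoι where
  right_cancellation k l h := by
    have h₁ := B.isInverse_iso.precomp k
    have h₂ := B.isInverse_iso.precomp l
    rw [h] at h₁
    have h' := h₁.unique h₂
    have h₃ : k ≫ B.isoPair = l ≫ B.isoPair := by
      apply B.split_ext
      · simpa only [isoι, Category.assoc] using h
      · simpa only [isoInv, Category.assoc] using h'
    have h₄ : k ≫ B.isoPair' = l ≫ B.isoPair' := by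
      apply B.split_ext
      · simpa only [isoInv_eq, Category.assoc] using h'
      · simpa only [isoι_eq, Category.assoc] using h
    exact pullback.hom_ext h₃ h₄

/-- The morphism `iso(F)₁ : iso(A)₁ ⟶ iso(B)₁`. -/
def isoMap {A B : InternalCat C} (F : A ⟶ B) : A.isoArr ⟶ B.isoArr :=
  (B.exists_isoLift (A.isInverse_iso.comp_arr F)).choose

lemma isoMap_ι {A B : InternalCat C} (F : A ⟶ B) : isoMap F ≫ B.isoι = A.isoι ≫ F.arr :=
  (B.exists_isoLift (A.isInverse_iso.comp_arr F)).choose_spec.1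

variable {A B : InternalCat C}

/-- The mapping path object `(P_F)₀`, the pullback of the target `iso(B)₁ ⟶ B₀` and
`F₀ : A₀ ⟶ B₀`: it consists of the pairs `(a, b ≅ F a)`. -/
def pathObj (F : A ⟶ B) : C := pullback (B.isoι ≫ B.tgt) F.obj

/-- The morphism `(P_F)₀ ⟶ B₀`, `(a, b ≅ F a) ↦ b`. -/
def pathSrc (F : A ⟶ B) : pathObj F ⟶ B.obj :=
  pullback.fst (B.isoι ≫ B.tgt) F.obj ≫ B.isoι ≫ B.src

/-- The morphism `(r_F)₀ : iso(A)₁ ⟶ (P_F)₀`, `(a' ≅ a) ↦ (a, F a' ≅ F a)`. -/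
def pathLift (F : A ⟶ B) : A.isoArr ⟶ pathObj F :=
  pullback.lift (isoMap F) (A.isoι ≫ A.tgt) (by
    rw [← Category.assoc, isoMap_ι, Category.assoc, Category.assoc, Hom.arr_tgt])

/-- `F` is fully faithful if `A₁` is the pullback of `B₁` along `F₀ × F₀`. -/
def FullyFaithful (F : A ⟶ B) : Prop :=
  IsPullback F.arr (prod.lift A.src A.tgt) (prod.lift B.src B.tgt) (prod.map F.obj F.obj)

/-- `p` is a `J`-epimorphism if its image under the Yoneda embedding followed by
sheafification is an epimorphism of sheaves. -/
def IsTopEpi (J : GrothendieckTopology C) {E B : C} (p : E ⟶ B) : Prop :=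
  Epi ((presheafToSheaf J (Type (max u v))).map (uliftYoneda.{u}.map p))

/-- The `J`-equivalences: fully faithful and essentially `J`-surjective internal functors. -/
def topWE (J : GrothendieckTopology C) : MorphismProperty (InternalCat C) :=
  fun _ _ F => FullyFaithful F ∧ IsTopEpi J (pathSrc F)

/-- The `J`-fibrations. -/
def topFib (J : GrothendieckTopology C) : MorphismProperty (InternalCat C) :=
  fun _ _ F => IsTopEpi J (pathLift F)

/-- The `J`-cofibrations. -/
def topCof (J : GrothendieckTopology C) : MorphismProperty (InternalCat C) :=
  (topWE J ⊓ topFib J).llp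

end topology

end

end InternalCat

namespace GraphPullback

variable {X Y Z : Type u} [Quiver.{u} X] [Quiver.{u} Y] [Quiver.{u} Z] (f : X ⥤q Z) (g : Y ⥤q Z)

/-- The vertices of the pullback of two graph morphisms. -/
def Vert : Type u := { p : X × Y // f.obj p.1 = g.obj p.2 }

variable {f g} in
/-- The vertex of the pullback given by two vertices with the same image. -/
def Vert.mk {x : X} {y : Y} (h : f.obj x = g.obj y) : Vert f g := ⟨(x, y), h⟩

instance : Quiver.{u} (Vert f g) where
  Hom p q := { e : (p.1.1 ⟶ q.1.1) × (p.1.2 ⟶ q.1.2) // f.map e.1 ≍ g.map e.2 }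

/-- First projection. -/
def fst : Vert f g ⥤q X where
  obj p := p.1.1
  map e := e.1.1

/-- Second projection. -/
def snd : Vert f g ⥤q Y where
  obj p := p.1.2
  map e := e.1.2

variable {f g}

lemma map_heq {P W : Type u} [Quiver.{u} P] [Quiver.{u} W] (F : P ⥤q W) {a b c d : P}
    {e : a ⟶ b} {e' : c ⟶ d} (h₁ : a = c) (h₂ : b = d) (h : e ≍ e') : F.map e ≍ F.map e' := by
  subst h₁ h₂ h
  rfl

lemma map_heq_of_eq {P W : Type u} [Quiver.{u} P] [Quiver.{u} W] {F G : P ⥤q W} (h : F = G)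
    {a b : P} (e : a ⟶ b) : F.map e ≍ G.map e := by
  subst h
  rfl

lemma prefunctor_ext {P W : Type u} [Quiver.{u} P] [Quiver.{u} W] {F G : P ⥤q W}
    (h₀ : ∀ a, F.obj a = G.obj a) (h₁ : ∀ {a b} (e : a ⟶ b), F.map e ≍ G.map e) : F = G := by
  obtain ⟨Fo, Fm⟩ := F
  obtain ⟨Go, Gm⟩ := G
  obtain rfl : Fo = Go := funext h₀
  congr
  funext a b e
  exact eq_of_heq (h₁ e)

/-- The two projections of the pullback jointly determine a path. -/
lemma path_ext {p q : Vert f g} (r r' : Quiver.Path p q)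
    (h₁ : (fst f g).mapPath r = (fst f g).mapPath r')
    (h₂ : (snd f g).mapPath r = (snd f g).mapPath r') : r = r' := by
  induction r with
  | nil =>
    cases r' with
    | nil => rfl
    | cons r' e' => simp at h₁
  | cons r e ih =>
    cases r' with
    | nil => simp at h₁
    | cons r' e' =>
      simp only [Prefunctor.mapPath_cons] at h₁ h₂
      have a₁ := Quiver.Path.obj_eq_of_cons_eq_cons h₁
      have a₂ := Quiver.Path.obj_eq_of_cons_eq_cons h₂
      obtain rfl := Subtype.ext (Prod.ext a₁ a₂)
      have b₁ := eq_of_heq (Quiver.Path.heq_of_cons_eq_cons h₁)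
      have b₂ := eq_of_heq (Quiver.Path.heq_of_cons_eq_cons h₂)
      have c₁ := eq_of_heq (Quiver.Path.hom_heq_of_cons_eq_cons h₁)
      have c₂ := eq_of_heq (Quiver.Path.hom_heq_of_cons_eq_cons h₂)
      obtain rfl := ih r' b₁ b₂
      obtain rfl : e = e' := Subtype.ext (Prod.ext c₁ c₂)
      rfl

lemma cons_heq {a b c a' b' c' : Z} {p : Quiver.Path a b} {e : b ⟶ c} {p' : Quiver.Path a' b'}
    {e' : b' ⟶ c'} (ha : a = a') (hc : c = c') (h : p.cons e ≍ p'.cons e') :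
    b = b' ∧ p ≍ p' ∧ e ≍ e' := by
  subst ha hc
  have h := eq_of_heq h
  exact ⟨Quiver.Path.obj_eq_of_cons_eq_cons h, Quiver.Path.heq_of_cons_eq_cons h,
    Quiver.Path.hom_heq_of_cons_eq_cons h⟩

lemma nil_cons_heq {a a' b' c' : Z} {p' : Quiver.Path a' b'}
    {e' : b' ⟶ c'} (ha : a = a') (hc : a = c') : 
    ¬ (Quiver.Path.nil : Quiver.Path a a) ≍ p'.cons e' := by
  subst ha hc
  intro h
  exact Quiver.Path.nil_ne_cons _ _ (eq_of_heq h)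

/-- Two paths with the same image give a path in the pullback. -/
lemma exists_path {x x' : X} (r : Quiver.Path x x') {y y' : Y} (s : Quiver.Path y y')
    (h : f.obj x = g.obj y) (h' : f.obj x' = g.obj y') (hrs : f.mapPath r ≍ g.mapPath s) :
    ∃ t : Quiver.Path (Vert.mk h) (Vert.mk h'),
      (fst f g).mapPath t = r ∧ (snd f g).mapPath t = s := by
  induction r generalizing y' with
  | nil =>
    cases s with
    | nil => exact ⟨.nil, rfl, rfl⟩
    | cons s e => exact absurd hrs (nil_cons_heq h h')
  | cons r e ih =>
    cases s with
    | nil => exact absurd hrs.symm (nil_cons_heq h.symm h'.symm)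
    | cons s e' =>
      obtain ⟨h₀, h₁, h₂⟩ := cons_heq h h' hrs
      obtain ⟨t, rfl, rfl⟩ := ih s h₀ h₁
      exact ⟨t.cons ⟨(e, e'), h₂⟩, rfl, rfl⟩

lemma edge_ext {p q p' q' : Vert f g} (hp : p = p') (hq : q = q') (e : p ⟶ q) (e' : p' ⟶ q')
    (h₁ : (fst f g).map e ≍ (fst f g).map e') (h₂ : (snd f g).map e ≍ (snd f g).map e') :
    e ≍ e' := by
  subst hp hq
  exact heq_of_eq (Subtype.ext (Prod.ext (eq_of_heq h₁) (eq_of_heq h₂)))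

lemma path_ext' {p q p' q' : Vert f g} (hp : p = p') (hq : q = q') (e : Quiver.Path p q)
    (e' : Quiver.Path p' q') (h₁ : (fst f g).mapPath e ≍ (fst f g).mapPath e')
    (h₂ : (snd f g).mapPath e ≍ (snd f g).mapPath e') : e ≍ e' := by
  subst hp hq
  exact heq_of_eq (path_ext _ _ (eq_of_heq h₁) (eq_of_heq h₂))

end GraphPullback

namespace Graph

open GraphPullback

variable {X Y Z : Quiv.{u, u}} (f : X ⟶ Z) (g : Y ⟶ Z)

/-- The explicit pullback of graphs. -/
def pb : Quiv.{u, u} := Quiv.of (Vert (X := X) (Y := Y) (Z := Z) f g)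

def pbFst : pb f g ⟶ X := GraphPullback.fst (X := X) (Y := Y) (Z := Z) f g
def pbSnd : pb f g ⟶ Y := GraphPullback.snd (X := X) (Y := Y) (Z := Z) f g

lemma pb_ext {p q : pb f g} (h₁ : (pbFst f g).obj p = (pbFst f g).obj q)
    (h₂ : (pbSnd f g).obj p = (pbSnd f g).obj q) : p = q :=
  Subtype.ext (Prod.ext h₁ h₂)

variable {f g} in
/-- The vertex of the pullback given by two vertices with the same image. -/
def pbMk {x : X} {y : Y} (h : f.obj x = g.obj y) : pb f g :=
  Vert.mk (X := X) (Y := Y) (Z := Z) h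

lemma isPullback_pb : IsPullback (pbFst f g) (pbSnd f g) f g where
  w := prefunctor_ext (P := pb f g) (W := Z) (fun p => p.2) (fun e => e.2)
  isLimit' := ⟨PullbackCone.IsLimit.mk _
    (fun s =>
      { obj := fun a => Vert.mk (Prefunctor.congr_obj s.condition a)
        map := fun e => ⟨(s.fst.map e, s.snd.map e), map_heq_of_eq s.condition e⟩ })
    (fun _ => rfl) (fun _ => rfl) (by
      intro s m h₁ h₂
      have h₀ : ∀ a, m.obj a = pbMk (f := f) (g := g) (x := s.fst.obj a) (y := s.snd.obj a)
          (Prefunctor.congr_obj s.condition a) := fun a =>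
        pb_ext f g (Prefunctor.congr_obj h₁ a) (Prefunctor.congr_obj h₂ a)
      exact prefunctor_ext h₀ (fun e => edge_ext (h₀ _) (h₀ _) _ _
        (map_heq_of_eq h₁ e) (map_heq_of_eq h₂ e)))⟩

/-- The endofunctor of graphs sending a graph to the graph of its paths. -/
abbrev pathFunctor : Quiv.{u, u} ⥤ Quiv.{u, u} := Cat.free ⋙ Quiv.forget

lemma isPullback_path_pb : IsPullback (pathFunctor.map (pbFst f g)) (pathFunctor.map (pbSnd f g))
    (pathFunctor.map f) (pathFunctor.map g) where
  w := by rw [← Functor.map_comp, ← Functor.map_comp, (isPullback_pb f g).w]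
  isLimit' := ⟨by
    have key (s : PullbackCone (pathFunctor.map f) (pathFunctor.map g)) {a b : s.pt} (e : a ⟶ b) :=
      exists_path (X := X) (Y := Y) (Z := Z) (f := f) (g := g) (s.fst.map e) (s.snd.map e)
        (Prefunctor.congr_obj s.condition a) (Prefunctor.congr_obj s.condition b)
        (map_heq_of_eq s.condition e)
    refine PullbackCone.IsLimit.mk _
      (fun s =>
        { obj := fun a => Vert.mk (Prefunctor.congr_obj s.condition a)
          map := fun e => (key s e).choose })
      (fun s => ?_) (fun s => ?_) ?_
    · exact prefunctor_ext (fun _ => rfl) (fun e => heq_of_eq (key s e).choose_spec.1)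
    · exact prefunctor_ext (fun _ => rfl) (fun e => heq_of_eq (key s e).choose_spec.2)
    · intro s m h₁ h₂
      have h₀ : ∀ a, m.obj a = pbMk (f := f) (g := g) (x := s.fst.obj a) (y := s.snd.obj a)
          (Prefunctor.congr_obj s.condition a) := fun a =>
        pb_ext f g (Prefunctor.congr_obj h₁ a) (Prefunctor.congr_obj h₂ a)
      refine prefunctor_ext h₀ (fun e => path_ext' (h₀ _) (h₀ _) _ _ ?_ ?_)
      · exact (map_heq_of_eq h₁ e).trans (heq_of_eq (key s e).choose_spec.1.symm)
      · exact (map_heq_of_eq h₂ e).trans (heq_of_eq (key s e).choose_spec.2.symm)⟩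

instance : HasPullbacks Quiv.{u, u} :=
  have {X Y Z : Quiv.{u, u}} {f : X ⟶ Z} {g : Y ⟶ Z} : HasLimit (cospan f g) :=
    (isPullback_pb f g).hasPullback
  hasPullbacks_of_hasLimit_cospan _

instance : PreservesLimitsOfShape WalkingCospan pathFunctor.{u} where
  preservesLimit {K} := by
    suffices h : PreservesLimit (cospan (K.map WalkingCospan.Hom.inl)
        (K.map WalkingCospan.Hom.inr)) pathFunctor.{u} from
      preservesLimit_of_iso_diagram _ (diagramIsoCospan K).symm
    exact preservesLimit_of_preserves_limit_cone (isPullback_pb _ _).isLimit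
      ((isLimitMapConePullbackConeEquiv pathFunctor (isPullback_pb _ _).w).symm
        (isPullback_path_pb _ _).isLimit)

end Graph

/-! ### The categorically surjective topology -/

/-- A functor is categorically surjective if it is surjective on objects and full. -/
def CategoricallySurjective {X Y : Cat.{u, u}} (F : X ⟶ Y) : Prop :=
  Function.Surjective F.toFunctor.obj ∧ F.toFunctor.Full

namespace CatPullback

variable {X Y Z : Type u} [Category.{u} X] [Category.{u} Y] [Category.{u} Z] (F : X ⥤ Z) (G : Y ⥤ Z)

/-- The objects of the strict pullback of two functors. -/
structure Obj : Type u where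
  left : X
  right : Y
  w : F.obj left = G.obj right

variable {F G} in
/-- The morphisms of the strict pullback of two functors. -/
@[ext]
structure Hom (p q : Obj F G) : Type u where
  left : p.left ⟶ q.left
  right : p.right ⟶ q.right
  w : F.map left = eqToHom p.w ≫ G.map right ≫ eqToHom q.w.symm

instance : Category.{u} (Obj F G) where
  Hom := Hom
  id p := ⟨𝟙 _, 𝟙 _, by simp⟩
  comp a b := ⟨a.left ≫ b.left, a.right ≫ b.right, by simp [a.w, b.w]⟩
  id_comp a := Hom.ext (Category.id_comp _) (Category.id_comp _)
  comp_id a := Hom.ext (Category.comp_id _) (Category.comp_id _)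
  assoc a b c := Hom.ext (Category.assoc _ _ _) (Category.assoc _ _ _)

/-- First projection. -/
def left : Obj F G ⥤ X where
  obj p := p.left
  map a := Hom.left a
  map_id _ := rfl
  map_comp _ _ := rfl

/-- Second projection. -/
def right : Obj F G ⥤ Y where
  obj p := p.right
  map a := Hom.right a
  map_id _ := rfl
  map_comp _ _ := rfl

lemma w : left F G ⋙ F = right F G ⋙ G :=
  CategoryTheory.Functor.ext (fun p => Obj.w p) (fun _ _ a => Hom.w a)

end CatPullback

lemma CategoricallySurjective.exists_pullback {X Y Z : Cat.{u, u}} {F : X ⟶ Z}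
    (hF : CategoricallySurjective F) (G : Y ⟶ Z) :
    ∃ (P : Cat.{u, u}) (p : P ⟶ Y) (q : P ⟶ X), CategoricallySurjective p ∧ p ≫ G = q ≫ F := by
  refine ⟨Cat.of (CatPullback.Obj F.toFunctor G.toFunctor),
    (CatPullback.right F.toFunctor G.toFunctor).toCatHom,
    (CatPullback.left F.toFunctor G.toFunctor).toCatHom, ⟨?_, ⟨?_⟩⟩, ?_⟩
  · intro y
    obtain ⟨x, hx⟩ := hF.1 (G.toFunctor.obj y)
    exact ⟨⟨x, y, hx⟩, rfl⟩
  · intro a b g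
    have := hF.2
    obtain ⟨f, hf⟩ := F.toFunctor.map_surjective
      (eqToHom a.w ≫ G.toFunctor.map g ≫ eqToHom b.w.symm)
    exact ⟨⟨f, g, hf⟩, rfl⟩
  · exact Cat.Hom.ext (CatPullback.w _ _).symm

/-- The topology `τ'` on `Cat` with basis the single categorically surjective functors: a sieve
covers if and only if it contains a categorically surjective functor. -/
def catSurjTopology : GrothendieckTopology Cat.{u, u} where
  sieves X := { S | ∃ (D : Cat.{u, u}) (F : D ⟶ X), CategoricallySurjective F ∧ S F }
  top_mem' X := ⟨X, 𝟙 X, ⟨fun x => ⟨x, rfl⟩, ⟨fun f => ⟨f, rfl⟩⟩⟩, trivial⟩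
  pullback_stable' := by
    rintro X Y S G ⟨D, F, hF, hS⟩
    obtain ⟨P, p, q, hp, h⟩ := hF.exists_pullback G
    refine ⟨P, p, hp, ?_⟩
    change S (p ≫ G)
    rw [h]
    exact S.downward_closed hS q
  transitive' := by
    rintro X S ⟨D, F, hF, hS⟩ R hR
    obtain ⟨E, G, hG, hR'⟩ := hR hS
    refine ⟨E, G ≫ F, ⟨hF.1.comp hG.1, ?_⟩, hR'⟩
    have := hF.2
    have := hG.2
    exact inferInstanceAs (G.toFunctor ⋙ F.toFunctor).Full

/-- A functor is `U`-split if its underlying graph morphism has a section. -/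
def USplit {E B : Cat.{u, u}} (p : E ⟶ B) : Prop :=
  ∃ q : Quiv.forget.obj B ⟶ Quiv.forget.obj E, q ≫ Quiv.forget.map p = 𝟙 (Quiv.forget.obj B)

/-! ### Double categories as algebras -/

/-- The category `DblCat = Cat(Cat)` of small double categories and double functors. -/
abbrev DblCat : Type (u + 1) := InternalCat Cat.{u, u}

namespace DblCat

/-- The monad `M` on graphs whose algebras are small categories. -/
abbrev graphMonad : Monad Quiv.{u, u} := Quiv.adj.toMonad

instance : PreservesLimitsOfShape WalkingCospan graphMonad.{u}.toFunctor :=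
  inferInstanceAs (PreservesLimitsOfShape WalkingCospan Graph.pathFunctor.{u})

noncomputable section

/-- The monad `M̄` on `Cat(Graph)` induced by `M`. -/
abbrev doubleMonad : Monad (InternalCat Quiv.{u, u}) := InternalCat.mapMonad graphMonad.{u}

/-- The category of strict `M̄`-algebras and strict morphisms. -/
abbrev Alg : Type (u + 1) := doubleMonad.{u}.Algebra

instance : PreservesLimitsOfShape WalkingCospan Quiv.forget.{u, u} :=
  have := Quiv.adj.{u, u}.rightAdjoint_preservesLimits
  inferInstance

/-- The identification of double categories with `M̄`-algebras: `𝔻 ↦ (Ū𝔻, vertical composition)`. -/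
def toAlg : DblCat.{u} ⥤ Alg.{u} := InternalCat.comparison Quiv.adj.{u, u}

/-- The underlying internal category in graphs of `toAlg 𝔻` is `Ū𝔻`. -/
lemma toAlg_forget : toAlg.{u} ⋙ doubleMonad.forget = InternalCat.map Quiv.forget := rfl

/-- Weak equivalences of the model structure on `M̄`-algebras transferred from the trivial model
structure on `Cat(Graph)`. -/
def algWE : MorphismProperty Alg.{u} := InternalCat.trivialWE.inverseImage doubleMonad.forget

/-- Fibrations of the transferred model structure on `M̄`-algebras. -/
def algFib : MorphismProperty Alg.{u} := InternalCat.trivialFib.inverseImage doubleMonad.forget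

/-- Cofibrations of the transferred model structure on `M̄`-algebras. -/
def algCof : MorphismProperty Alg.{u} := (algWE ⊓ algFib).llp

end

end DblCat

/-! The argument has four ingredients.

Monadicity passes to internal categories. Let `R` be monadic with monad `T`, both preserving
pullbacks. An algebra for the induced monad on internal categories has `T`-algebras of objects and
of arrows. Composable pairs carry the pullback algebra structure, and the action being an internal
functor says precisely that source, target, unit and composition are algebra morphisms. It is thus
an internal category in `T`-algebras, hence in the domain of `R` (`isEquivalence_comparison`). That
the path adjunction is monadic is checked by hand: an action of paths is a category structure.

The trivial model structure can be tested on discrete internal categories. Generalised objects and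
arrows are functors and 2-cells out of `disc X`, so equivalences and isofibrations become lifting
conditions on generalised elements. Conversely, these conditions suffice for every `E`, since an
internal functor can be conjugated along an invertible family of arrows (`exists_conj`). This gives
`trivialWE_iff` and `trivialFib_iff`.

For a functor in the image of `R`, a lifting condition over all stages `X` is decided at one generic
stage: essential surjectivity becomes a section of `R (pathSrc G)`, the isofibration condition a
section of `R (pathLift G)`. Full faithfulness is both preserved and reflected by `R`
(`liftsArr_map_iff`). For graphs and categories these sections are `U`-splittings.

Finally, `τ'`-epimorphisms are the `U`-split functors. A functor is a `τ'`-epimorphism when some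
categorically surjective functor factors through it. Categorically surjective functors are `U`-split
by choice; conversely, the counit from the free category on `U B` is categorically surjective and
factors through every `U`-split functor to `B`, by adjunction.

Cofibrations then agree because left lifting properties are transported along equivalences. -/

namespace InternalCat

variable {C : Type u} [Category.{v} C]

noncomputable section

/-! ### Calculus of invertible generalised arrows. -/

section invertible

variable {B : InternalCat C} {X : C}

lemma IsInverse.symm {x y : X ⟶ B.arr} (h : B.IsInverse x y) : B.IsInverse y x := by
  obtain ⟨h₁, h₂, h₃, h₄⟩ := h
  exact ⟨h₂, h₁, h₄, h₃⟩

lemma IsInverse.w {x y : X ⟶ B.arr} (h : B.IsInverse x y) : x ≫ B.tgt = y ≫ B.src := by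
  obtain ⟨h₁, h₂, h₃, h₄⟩ := h
  exact h₁

lemma IsInverse.hcomp_hcomp_cancel {x y : X ⟶ B.arr} (h : B.IsInverse x y) (z : X ⟶ B.arr)
    (hz : z ≫ B.tgt = x ≫ B.src) :
    B.hcomp (B.hcomp z x hz) y (by simpa using h.w) = z := by
  obtain ⟨h₁, h₂, h₃, h₄⟩ := h
  rw [B.hcomp_assoc _ _ _ hz h₁]
  simp only [h₃, ← Category.assoc, hcomp_unit]

lemma IsInverse.cancel_hcomp_hcomp {x y : X ⟶ B.arr} (h : B.IsInverse x y) (z : X ⟶ B.arr)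
    (hz : y ≫ B.tgt = z ≫ B.src) :
    B.hcomp x (B.hcomp y z hz) (by simpa using h.w) = z := by
  obtain ⟨h₁, h₂, h₃, h₄⟩ := h
  rw [← B.hcomp_assoc _ _ _ h₁ hz]
  simp only [h₃, ← Category.assoc, unit_hcomp]

lemma IsInverse.cancel_right {x y : X ⟶ B.arr} (h : B.IsInverse x y) {z z' : X ⟶ B.arr}
    (hz : z ≫ B.tgt = x ≫ B.src) (hz' : z' ≫ B.tgt = x ≫ B.src)
    (e : B.hcomp z x hz = B.hcomp z' x hz') : z = z' := by
  have h₁ := h.hcomp_hcomp_cancel z hz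
  simp only [e] at h₁
  rw [← h₁]
  exact h.hcomp_hcomp_cancel z' hz'

lemma IsInverse.unit (a : X ⟶ B.obj) : B.IsInverse (a ≫ B.unit) (a ≫ B.unit) :=
  ⟨by simp, by simp, by rw [unit_hcomp]; simp, by rw [unit_hcomp]; simp⟩

end invertible

/-! ### The trivial model structure in terms of generalised elements. -/

variable {A B D E : InternalCat C}

lemma isInverse_app {F G : A ⟶ B} (α : F ≅ G) :
    B.IsInverse (Cell.app α.hom) (Cell.app α.inv) := by
  refine ⟨by simp, by simp, ?_, ?_⟩
  · have h := congrArg Cell.app α.hom_inv_id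
    rw [cell_comp_app] at h
    rw [h]
    simp
  · have h := congrArg Cell.app α.inv_hom_id
    rw [cell_comp_app] at h
    rw [h]
    simp

/-- A 2-cell whose components are invertible is invertible. -/
def isoOfIsInverse {F G : A ⟶ B} (α : F ⟶ G) (y : A.obj ⟶ B.arr)
    (h : B.IsInverse (Cell.app α) y) : F ≅ G where
  hom := α
  inv :=
    { app := y
      app_src := by rw [← h.w, Cell.app_tgt]
      app_tgt := by rw [h.symm.w, Cell.app_src]
      naturality := by
        have ys : y ≫ B.src = G.obj := by rw [← h.w, Cell.app_tgt]
        have yt : y ≫ B.tgt = F.obj := by rw [h.symm.w, Cell.app_src]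
        -- Composing the naturality square of `α` with `y` on the left gives `y F α = G`; composing
        -- this with `y` on the right gives `y F = G y`.
        have hn := (h.precomp A.src).symm.cancel_hcomp_hcomp G.arr (by simp)
        simp only [← Cell.naturality α] at hn
        rw [← hcomp_assoc _ _ _ _ (by simp [yt]) (by simp)] at hn
        have ht := (h.precomp A.tgt).hcomp_hcomp_cancel (B.hcomp (A.src ≫ y) F.arr (by simp [yt]))
          (by simp)
        simpa only [hn] using ht }
  hom_inv_id := by
    ext
    obtain ⟨h₁, h₂, h₃, h₄⟩ := h
    exact h₃.trans (by simp)
  inv_hom_id := by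
    ext
    obtain ⟨h₁, h₂, h₃, h₄⟩ := h
    exact h₄.trans (by rw [← Category.assoc, ← h₁]; simp)

/-- The discrete internal category on `X`. -/
def disc (X : C) : InternalCat C where
  obj := X
  arr := X
  pairs := X
  src := 𝟙 X
  tgt := 𝟙 X
  unit := 𝟙 X
  fst := 𝟙 X
  snd := 𝟙 X
  isPullback := .id_vert (𝟙 X)
  mul := 𝟙 X
  unit_src := by simp
  unit_tgt := by simp
  mul_src := by simp
  mul_tgt := by simp
  unit_mul := IsPullback.lift_snd _ _ _ _
  mul_unit := IsPullback.lift_fst _ _ _ _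
  mul_assoc {Y} x y z hxy hyz := by
    obtain rfl : x = y := by simpa using hxy
    obtain rfl : x = z := by simpa using hyz
    refine (IsPullback.lift_snd _ _ _ _).trans (IsPullback.lift_fst _ _ _ _).symm

/-- Generalised objects are internal functors on discrete internal categories. -/
def discHom {X : C} (a : X ⟶ A.obj) : disc X ⟶ A where
  obj := a
  arr := a ≫ A.unit
  arr_src := by simp [disc]
  arr_tgt := by simp [disc]
  unit_arr := by simp [disc]
  mul_arr := by simp only [disc, Category.id_comp, unit_hcomp]

/-- The unit of `disc X` is the identity of `X`, so preservation of units already fixes the arrow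
component. -/
lemma disc_arr {X : C} (f : disc X ⟶ A) : f.arr = (Hom.obj f : X ⟶ A.obj) ≫ A.unit := by
  have h := f.unit_arr
  exact (Category.id_comp _).symm.trans h

/-- Generalised arrows are 2-cells between internal functors on discrete internal categories. -/
def discCell {X : C} {f g : disc X ⟶ A} (x : X ⟶ A.arr) (hs : x ≫ A.src = f.obj)
    (ht : x ≫ A.tgt = g.obj) : f ⟶ g where
  app := x
  app_src := hs
  app_tgt := ht
  naturality := by
    simp only [disc_arr]
    simp only [disc, Category.id_comp, unit_hcomp, hcomp_unit]

lemma eqToHom_comp_app {F G H : A ⟶ B} (h : F = G) (α : G ⟶ H) :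
    Cell.app (eqToHom h ≫ α) = Cell.app α := by
  subst h
  simp

/-- Naturality writes `F.arr` followed by an invertible component in terms of `H`, and that
component cancels; so the components and the target determine the source. Isofibrations need this
strict equality, since a lift must lie exactly over the given functor. -/
lemma eq_of_isInverse_app {F G H : A ⟶ B} (α : F ⟶ H) (β : G ≅ H)
    (h : Cell.app α = Cell.app β.hom) : F = G := by
  have hi := (isInverse_app β).precomp A.tgt
  have h₀ : F.obj = G.obj := by
    rw [← Cell.app_src α, ← Cell.app_src β.hom, h]
  refine hom_ext h₀ (hi.cancel_right (by simp [h₀]) (by simp) ?_)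
  have h₁ := Cell.naturality α
  simp only [h] at h₁
  exact h₁.trans (Cell.naturality β.hom).symm

/-- Transport of an internal functor along an invertible family of arrows. -/
lemma exists_conj (e : E ⟶ A) {x y : E.obj ⟶ A.arr} (h : A.IsInverse x y)
    (ht : x ≫ A.tgt = e.obj) :
    ∃ (d : E ⟶ A) (α : d ≅ e), d.obj = x ≫ A.src ∧ Cell.app α.hom = x := by
  have hy : y ≫ A.src = e.obj := by rw [← h.w, ht]
  -- Conjugation, with `y` the inverse of `x`: the only arrow part for which `x` is natural from `d`
  -- to `e`.
  let z : E.arr ⟶ A.arr :=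
    A.hcomp (A.hcomp (E.src ≫ x) e.arr (by simp [ht])) (E.tgt ≫ y) (by simp [hy])
  have hz : A.hcomp z (E.tgt ≫ x) (by simp [z, h.symm.w]) =
      A.hcomp (E.src ≫ x) e.arr (by simp [ht]) :=
    (h.precomp E.tgt).symm.hcomp_hcomp_cancel _ _
  let d : E ⟶ A :=
    { obj := x ≫ A.src
      arr := z
      arr_src := by simp [z]
      arr_tgt := by simp [z, h.symm.w]
      unit_arr := by
        obtain ⟨h₁, h₂, h₃, h₄⟩ := h
        have hu : A.hcomp x (e.obj ≫ A.unit) (by simp [ht]) = x := hcomp_unit _ _ _ _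
        simp only [z, comp_hcomp, unit_src_assoc, unit_tgt_assoc, Hom.unit_arr, hu, h₃,
          Category.assoc]
      mul_arr := by
        have hs : E.mul ≫ E.src ≫ x = E.fst ≫ E.src ≫ x := by
          rw [← Category.assoc, E.mul_src, Category.assoc]
        have ht' : E.mul ≫ E.tgt ≫ y = E.snd ≫ E.tgt ≫ y := by
          rw [← Category.assoc, E.mul_tgt, Category.assoc]
        have hw : E.fst ≫ E.tgt ≫ x = E.snd ≫ E.src ≫ x := by
          rw [← Category.assoc, E.isPullback.w, Category.assoc]
        have hw' : E.fst ≫ E.tgt ≫ e.obj = E.snd ≫ E.src ≫ e.obj := by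
          rw [← Category.assoc, E.isPullback.w, Category.assoc]
        have hwy : E.fst ≫ E.tgt ≫ y ≫ A.tgt = E.snd ≫ E.src ≫ x ≫ A.src := by
          rw [h.symm.w, reassoc_of% hw]
        -- In the composite of two conjugates the `y` closing the first factor meets the `x` opening
        -- the second, and they cancel.
        have hf : A.hcomp (E.fst ≫ z) (E.snd ≫ E.src ≫ x) (by simp [z, hwy]) =
            A.hcomp (E.fst ≫ E.src ≫ x) (E.fst ≫ e.arr) (by simp [ht]) := by
          have := congrArg (fun t => E.fst ≫ t) hz
          simpa only [comp_hcomp, hw] using this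
        have hg : E.snd ≫ z = A.hcomp (E.snd ≫ E.src ≫ x)
            (A.hcomp (E.snd ≫ e.arr) (E.snd ≫ E.tgt ≫ y) (by simp [hy])) (by simp [ht]) := by
          simp only [z, comp_hcomp]
          rw [hcomp_assoc]
        simp only [hg]
        rw [← hcomp_assoc _ _ _ _ (by simp [z, hwy]) (by simp [ht])]
        simp only [hf]
        rw [← hcomp_assoc _ _ _ _ (by simp [hw']) (by simp [hy])]
        have ha := A.hcomp_assoc (E.fst ≫ E.src ≫ x) (E.fst ≫ e.arr) (E.snd ≫ e.arr)
          (by simp [ht]) (by simp [hw'])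
        simp only [z, comp_hcomp, hs, ht', e.mul_arr, ha] }
  exact ⟨d, isoOfIsInverse (F := d) { app := x, app_src := rfl, app_tgt := ht, naturality := hz }
    y h, rfl, rfl⟩

/-- Invertible arrows of `B` with target in the image of `F` lift to `A`. -/
def LiftsIso (F : A ⟶ B) : Prop :=
  ∀ ⦃X : C⦄ (a : X ⟶ A.obj) (x y : X ⟶ B.arr), B.IsInverse x y → x ≫ B.tgt = a ≫ F.obj →
    ∃ x' y' : X ⟶ A.arr, A.IsInverse x' y' ∧ x' ≫ A.tgt = a ∧ x' ≫ F.arr = x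

/-- Arrows of `B` between objects in the image of `F` lift uniquely to `A`. -/
def LiftsArr (F : A ⟶ B) : Prop :=
  ∀ ⦃X : C⦄ (a a' : X ⟶ A.obj) (x : X ⟶ B.arr), x ≫ B.src = a ≫ F.obj → x ≫ B.tgt = a' ≫ F.obj →
    ∃! x' : X ⟶ A.arr, x' ≫ F.arr = x ∧ x' ≫ A.src = a ∧ x' ≫ A.tgt = a'

/-- Every object of `B` is isomorphic to one in the image of `F`. -/
def ReachesObj (F : A ⟶ B) : Prop :=
  ∀ ⦃X : C⦄ (b : X ⟶ B.obj), ∃ (a : X ⟶ A.obj) (x y : X ⟶ B.arr),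
    B.IsInverse x y ∧ x ≫ B.src = b ∧ x ≫ B.tgt = a ≫ F.obj

/-- Evaluating at `disc X` extracts the lifting of one invertible arrow at stage `X`. For general
`E` it is enough to lift the components at stage `E.obj`: `exists_conj` turns the lifted family into
an isomorphism of functors, and `eq_of_isInverse_app` shows that its source lies over the given one.
-/
lemma trivialFib_iff (F : A ⟶ B) : trivialFib F ↔ LiftsIso F := by
  constructor
  · intro hF X a x y h ht
    obtain ⟨b', α, h₁, h₂⟩ := hF (disc X) (discHom a) (discHom (x ≫ B.src))
      (isoOfIsInverse (discCell (f := discHom (x ≫ B.src)) (g := discHom a ≫ F) x rfl ht) y h)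
    refine ⟨Cell.app α.hom, Cell.app α.inv, isInverse_app α, Cell.app_tgt α.hom, ?_⟩
    have h₃ := congrArg Cell.app h₂
    rw [eqToHom_comp_app] at h₃
    exact h₃
  · intro hF E e b β
    obtain ⟨x', y', h, ht, hx⟩ := hF e.obj _ _ (isInverse_app β) (Cell.app_tgt β.hom)
    obtain ⟨d, α, -, hα⟩ := exists_conj e h ht
    have h' : Cell.app ((postcomp E F).map α.hom) = Cell.app β.hom := by
      rw [postcomp_map_app, hα, hx]
    have hd : (postcomp E F).obj d = b := eq_of_isInverse_app _ β h'
    exact ⟨d, α, hd, cell_ext (by rw [eqToHom_comp_app, h'])⟩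

lemma LiftsArr.hom_ext {F : A ⟶ B} (hF : LiftsArr F) {X : C} {x y : X ⟶ A.arr}
    (h : x ≫ F.arr = y ≫ F.arr) (hs : x ≫ A.src = y ≫ A.src) (ht : x ≫ A.tgt = y ≫ A.tgt) :
    x = y :=
  (hF (y ≫ A.src) (y ≫ A.tgt) (y ≫ F.arr) (by simp) (by simp)).unique ⟨h, hs, ht⟩ ⟨rfl, rfl, rfl⟩

/-- The arrow part is lifted at the generic stage `E.arr`; the functor laws hold in `A` because they
hold in `B` and lifts are unique. -/
lemma LiftsArr.exists_hom {F : A ⟶ B} (hF : LiftsArr F) (b : E ⟶ B) (a : E.obj ⟶ A.obj)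
    (h : b.obj = a ≫ F.obj) : ∃ d : E ⟶ A, d.obj = a ∧ d ≫ F = b := by
  obtain ⟨x, ⟨hx, hs, ht⟩, -⟩ := hF (E.src ≫ a) (E.tgt ≫ a) b.arr (by simp [h]) (by simp [h])
  refine ⟨{ obj := a, arr := x, arr_src := hs, arr_tgt := ht, unit_arr := ?_, mul_arr := ?_ },
    rfl, InternalCat.hom_ext h.symm hx⟩
  · apply hF.hom_ext
    · simp [hx, h]
    · simp [hs]
    · simp [ht]
  · apply hF.hom_ext
    · rw [Hom.hcomp_arr]
      simp only [Category.assoc, hx, b.mul_arr]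
    · simp only [hcomp_src, Category.assoc, hs]
      rw [← Category.assoc, E.mul_src, Category.assoc]
    · simp only [hcomp_tgt, Category.assoc, ht]
      rw [← Category.assoc, E.mul_tgt, Category.assoc]

/-- At `disc X`, full faithfulness is unique lifting of arrows and essential surjectivity is
reaching objects. In the other direction, uniqueness of lifts makes any lifted 2-cell natural. -/
lemma trivialWE_iff (F : A ⟶ B) : trivialWE F ↔ LiftsArr F ∧ ReachesObj F := by
  constructor
  · intro hF
    refine ⟨fun X a a' x hs ht => ?_, fun X b => ?_⟩
    · have := hF (disc X)
      obtain ⟨α, hα⟩ := (postcomp (disc X) F).map_surjective (X := discHom a) (Y := discHom a')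
        (discCell x hs ht)
      refine ⟨Cell.app α, ⟨congrArg Cell.app hα, Cell.app_src α, Cell.app_tgt α⟩, ?_⟩
      rintro y ⟨hy, hys, hyt⟩
      have : discCell (f := discHom a) (g := discHom a') y hys hyt = α := by
        apply (postcomp (disc X) F).map_injective
        rw [hα]
        exact cell_ext hy
      rw [← this]
      rfl
    · have := hF (disc X)
      let i := ((postcomp (disc X) F).objObjPreimageIso (discHom b)).symm
      exact ⟨_, _, _, isInverse_app i, Cell.app_src i.hom, Cell.app_tgt i.hom⟩
  · rintro ⟨hF, hF'⟩ E
    refine { faithful := ⟨?_⟩, full := ⟨?_⟩, essSurj := ⟨?_⟩ }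
    · intro a a' α β h
      exact cell_ext (hF.hom_ext (congrArg Cell.app h) (by simp) (by simp))
    · intro a a' β
      obtain ⟨x, ⟨hx, hs, ht⟩, -⟩ := hF a.obj a'.obj (Cell.app β)
        (Cell.app_src β) (Cell.app_tgt β)
      refine ⟨{ app := x, app_src := hs, app_tgt := ht, naturality := ?_ }, cell_ext hx⟩
      apply hF.hom_ext
      · simp only [Hom.hcomp_arr, Category.assoc, hx]
        exact Cell.naturality β
      · simp [hs]
      · simp [ht]
    · intro b
      obtain ⟨a, x, y, h, hs, ht⟩ := hF' b.obj
      -- `exists_hom` needs the object part to factor strictly through `F.obj`, so `b` is first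
      -- replaced by an isomorphic functor for which it does.
      obtain ⟨b', β, h₀, -⟩ := exists_conj b h.symm (by rw [h.symm.w, hs])
      obtain ⟨d, -, hd⟩ := hF.exists_hom b' a (by rw [h₀, ← h.w, ht])
      exact ⟨d, ⟨eqToIso hd ≪≫ β⟩⟩

/-! ### Stability of the lifting conditions under composition and isomorphism. -/

section closure

variable {C : Type u} [Category.{v} C] {A B D : InternalCat C}

lemma LiftsIso.comp {F : A ⟶ B} {G : B ⟶ D} (hF : LiftsIso F) (hG : LiftsIso G) :
    LiftsIso (F ≫ G) := by
  intro X a x y h ht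
  obtain ⟨x₁, y₁, h₁, ht₁, rfl⟩ := hG (a ≫ F.obj) x y h (by simpa using ht)
  obtain ⟨x₂, y₂, h₂, ht₂, rfl⟩ := hF a x₁ y₁ h₁ ht₁
  exact ⟨x₂, y₂, h₂, ht₂, by simp⟩

lemma LiftsArr.comp {F : A ⟶ B} {G : B ⟶ D} (hF : LiftsArr F) (hG : LiftsArr G) :
    LiftsArr (F ≫ G) := by
  intro X a a' x hs ht
  obtain ⟨y, ⟨rfl, hys, hyt⟩, -⟩ := hG (a ≫ F.obj) (a' ≫ F.obj) x (by simpa using hs)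
    (by simpa using ht)
  obtain ⟨z, ⟨rfl, rfl, rfl⟩, -⟩ := hF a a' y hys hyt
  refine ⟨z, ⟨by simp, rfl, rfl⟩, ?_⟩
  rintro w ⟨hw, hws, hwt⟩
  refine hF.hom_ext (hG.hom_ext (by simpa using hw) ?_ ?_) hws hwt
  · simp [reassoc_of% hws]
  · simp [reassoc_of% hwt]

lemma IsInverse.hcomp {B : InternalCat C} {X : C} {x y x' y' : X ⟶ B.arr} (h : B.IsInverse x y)
    (h' : B.IsInverse x' y') (e : x ≫ B.tgt = x' ≫ B.src) :
    B.IsInverse (B.hcomp x x' e) (B.hcomp y' y (by rw [h'.symm.w, ← e, h.w])) := by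
  have key {a b a' b' : X ⟶ B.arr} (k : B.IsInverse a b) (k' : B.IsInverse a' b')
      (e : a ≫ B.tgt = a' ≫ B.src) :
      B.hcomp (B.hcomp a a' e) (B.hcomp b' b (by rw [k'.symm.w, ← e, k.w])) (by simp [k'.w]) =
        B.hcomp a a' e ≫ B.src ≫ B.unit := by
    have h₁ := k'.hcomp_hcomp_cancel a e
    rw [← hcomp_assoc _ _ _ _ (by simp [k'.w]) (by rw [k'.symm.w, ← e, k.w])]
    simp only [h₁]
    obtain ⟨h₁, h₂, h₃, h₄⟩ := k
    rw [h₃, ← Category.assoc (B.hcomp a a' e), hcomp_src, Category.assoc]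
  exact ⟨by simp [h'.w], by simp [h.symm.w], key h h' e, key h'.symm h.symm _⟩

lemma ReachesObj.comp {F : A ⟶ B} {G : B ⟶ D} (hF : ReachesObj F) (hG : ReachesObj G) :
    ReachesObj (F ≫ G) := by
  intro X d
  obtain ⟨b, x, y, h, rfl, hb⟩ := hG d
  obtain ⟨a, x', y', h', rfl, ha⟩ := hF b
  refine ⟨a, D.hcomp x (x' ≫ G.arr) (by simp [hb]), _, h.hcomp (h'.comp_arr G) _, by simp, ?_⟩
  simp [reassoc_of% ha]

section iso

variable (i : A ≅ B)

@[simp] lemma iso_hom_inv_arr : i.hom.arr ≫ i.inv.arr = 𝟙 _ := congrArg Hom.arr i.hom_inv_id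
@[simp] lemma iso_inv_hom_arr : i.inv.arr ≫ i.hom.arr = 𝟙 _ := congrArg Hom.arr i.inv_hom_id
@[simp] lemma iso_hom_inv_obj : i.hom.obj ≫ i.inv.obj = 𝟙 _ := congrArg Hom.obj i.hom_inv_id
@[simp] lemma iso_inv_hom_obj : i.inv.obj ≫ i.hom.obj = 𝟙 _ := congrArg Hom.obj i.inv_hom_id

lemma liftsIso_iso : LiftsIso i.hom := by
  intro X a x y h ht
  exact ⟨x ≫ i.inv.arr, y ≫ i.inv.arr, h.comp_arr _, by simp [reassoc_of% ht], by simp⟩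

lemma liftsArr_iso : LiftsArr i.hom := by
  intro X a a' x hs ht
  refine ⟨x ≫ i.inv.arr, ⟨by simp, by simp [reassoc_of% hs], by simp [reassoc_of% ht]⟩, ?_⟩
  rintro y ⟨rfl, -, -⟩
  simp

lemma reachesObj_iso : ReachesObj i.hom := fun _ b =>
  ⟨b ≫ i.inv.obj, _, _, IsInverse.unit b, by simp, by simp⟩

end iso

/-- Invariance under isomorphism is a hypothesis of `llp_inverseImage`, used later for cofibrations.
Isomorphisms satisfy all the lifting conditions, so closure under composition suffices. -/
instance : (trivialFib (C := C)).RespectsIso :=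
  MorphismProperty.RespectsIso.mk _
    (fun i _ hF => (trivialFib_iff _).2 ((liftsIso_iso i).comp ((trivialFib_iff _).1 hF)))
    (fun i _ hF => (trivialFib_iff _).2 (((trivialFib_iff _).1 hF).comp (liftsIso_iso i)))

instance : (trivialWE (C := C)).RespectsIso :=
  MorphismProperty.RespectsIso.mk _
    (fun i _ hF => by
      rw [trivialWE_iff] at hF ⊢
      exact ⟨(liftsArr_iso i).comp hF.1, (reachesObj_iso i).comp hF.2⟩)
    (fun i _ hF => by
      rw [trivialWE_iff] at hF ⊢
      exact ⟨hF.1.comp (liftsArr_iso i), hF.2.comp (reachesObj_iso i)⟩)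

end closure

/-- The universal property of the pullback, with a map into a product split into its two components.
The right-hand side makes sense without products. -/
lemma fullyFaithful_iff {C : Type u} [Category.{v} C] [HasFiniteLimits C] {A B : InternalCat C}
    (F : A ⟶ B) : FullyFaithful F ↔ LiftsArr F := by
  constructor
  · intro h X a a' x hs ht
    change IsPullback _ _ _ _ at h
    have w : x ≫ prod.lift B.src B.tgt = prod.lift a a' ≫ prod.map F.obj F.obj := by
      ext <;> simp [hs, ht]
    have hl := h.lift_snd x (prod.lift a a') w
    refine ⟨h.lift x (prod.lift a a') w, ⟨h.lift_fst _ _ _, ?_, ?_⟩, ?_⟩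
    · simpa only [Category.assoc, prod.lift_fst] using hl =≫ prod.fst
    · simpa only [Category.assoc, prod.lift_snd] using hl =≫ prod.snd
    · rintro y ⟨hy, hys, hyt⟩
      apply h.hom_ext
      · rw [hy, h.lift_fst]
      · rw [hl]
        ext <;> simp [hys, hyt]
  · intro h
    have key (s : PullbackCone (prod.lift B.src B.tgt) (prod.map F.obj F.obj)) :=
      h (s.snd ≫ prod.fst) (s.snd ≫ prod.snd) s.fst
        (by simpa only [Category.assoc, prod.lift_fst, prod.map_fst] using s.condition =≫ prod.fst)
        (by simpa only [Category.assoc, prod.lift_snd, prod.map_snd] using s.condition =≫ prod.snd)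
    refine ⟨⟨by ext <;> simp⟩, ⟨PullbackCone.IsLimit.mk _ (fun s => (key s).choose)
      (fun s => (key s).choose_spec.1.1) (fun s => ?_) (fun s m h₁ h₂ => ?_)⟩⟩
    · have := (key s).choose_spec.1.2
      ext
      · rw [Category.assoc, prod.lift_fst, this.1]
      · rw [Category.assoc, prod.lift_snd, this.2]
    · refine (key s).choose_spec.2 m ⟨h₁, ?_, ?_⟩
      · rw [← h₂, Category.assoc, prod.lift_fst]
      · rw [← h₂, Category.assoc, prod.lift_snd]

/-! ### The mapping path object, and lifting conditions under a right adjoint. -/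

section path

variable {C : Type u} [Category.{v} C] [HasFiniteLimits C] {A B : InternalCat C} (F : A ⟶ B)

/-- The projection `(a, b ≅ F a) ↦ (b ≅ F a)`. -/
def pathFst : pathObj F ⟶ B.isoArr := pullback.fst (B.isoι ≫ B.tgt) F.obj

/-- The projection `(a, b ≅ F a) ↦ a`. -/
def pathSnd : pathObj F ⟶ A.obj := pullback.snd (B.isoι ≫ B.tgt) F.obj

lemma isPullback_pathObj : IsPullback (pathFst F) (pathSnd F) (B.isoι ≫ B.tgt) F.obj :=
  IsPullback.of_hasPullback _ _

lemma pathSrc_eq : pathSrc F = pathFst F ≫ B.isoι ≫ B.src := rfl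

lemma pathLift_fst : pathLift F ≫ pathFst F = isoMap F := pullback.lift_fst _ _ _

lemma pathLift_snd : pathLift F ≫ pathSnd F = A.isoι ≫ A.tgt := pullback.lift_snd _ _ _

end path

section adjunction

variable {C : Type u} [Category.{v} C] {D : Type u'} [Category.{v'} D]
  {L : C ⥤ D} {R : D ⥤ C} (adj : L ⊣ R) [PreservesLimitsOfShape WalkingCospan R]

section

variable [HasPullbacks D] {A B : InternalCat D}

/-- This and the next two lemmas hold by definition; they expose `R.obj` and `R.map` in place of
projections of `map R`, so that rewriting can see them. -/
lemma liftsIso_map_def (G : A ⟶ B) : LiftsIso ((map R).map G) ↔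
    ∀ ⦃X : C⦄ (a : X ⟶ R.obj A.obj) (x y : X ⟶ R.obj B.arr), (B.mapObj R).IsInverse x y →
      x ≫ R.map B.tgt = a ≫ R.map G.obj → ∃ x' y' : X ⟶ R.obj A.arr, (A.mapObj R).IsInverse x' y' ∧
        x' ≫ R.map A.tgt = a ∧ x' ≫ R.map G.arr = x := Iff.rfl

lemma liftsArr_map_def (G : A ⟶ B) : LiftsArr ((map R).map G) ↔
    ∀ ⦃X : C⦄ (a a' : X ⟶ R.obj A.obj) (x : X ⟶ R.obj B.arr),
      x ≫ R.map B.src = a ≫ R.map G.obj → x ≫ R.map B.tgt = a' ≫ R.map G.obj →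
      ∃! x' : X ⟶ R.obj A.arr, x' ≫ R.map G.arr = x ∧ x' ≫ R.map A.src = a ∧
        x' ≫ R.map A.tgt = a' := Iff.rfl

lemma reachesObj_map_def (G : A ⟶ B) : ReachesObj ((map R).map G) ↔
    ∀ ⦃X : C⦄ (b : X ⟶ R.obj B.obj), ∃ (a : X ⟶ R.obj A.obj) (x y : X ⟶ R.obj B.arr),
      (B.mapObj R).IsInverse x y ∧ x ≫ R.map B.src = b ∧ x ≫ R.map B.tgt = a ≫ R.map G.obj :=
  Iff.rfl

lemma homEquiv_hcomp {X : C} (x y : L.obj X ⟶ B.arr) (h : x ≫ B.tgt = y ≫ B.src) :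
    adj.homEquiv X B.arr (B.hcomp x y h) =
      (B.mapObj R).hcomp (adj.homEquiv X B.arr x) (adj.homEquiv X B.arr y)
        ((adj.homEquiv_naturality_right x B.tgt).symm.trans
          ((congrArg _ h).trans (adj.homEquiv_naturality_right y B.src))) := by
  simp only [Adjunction.homEquiv_unit]
  rw [mapObj_hcomp]
  exact comp_hcomp _ _ _ _ _

/-- Transposition is bijective and respects composition, so each equation of invertibility at stage
`X` becomes one at stage `L X`. -/
lemma isInverse_homEquiv_symm {X : C} {x y : X ⟶ R.obj B.arr}
    (h : (B.mapObj R).IsInverse x y) :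
    B.IsInverse ((adj.homEquiv X B.arr).symm x) ((adj.homEquiv X B.arr).symm y) := by
  obtain ⟨h₁, h₂, h₃, h₄⟩ := h
  refine ⟨?_, ?_, ?_, ?_⟩
  · apply (adj.homEquiv _ _).injective
    simp only [Adjunction.homEquiv_naturality_right, Equiv.apply_symm_apply]
    exact h₁
  · apply (adj.homEquiv _ _).injective
    simp only [Adjunction.homEquiv_naturality_right, Equiv.apply_symm_apply]
    exact h₂
  · apply (adj.homEquiv _ _).injective
    simp only [homEquiv_hcomp, Adjunction.homEquiv_naturality_right, Equiv.apply_symm_apply]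
    exact h₃.trans (by simp [mapObj])
  · apply (adj.homEquiv _ _).injective
    simp only [homEquiv_hcomp, Adjunction.homEquiv_naturality_right, Equiv.apply_symm_apply]
    exact h₄.trans (by simp [mapObj])

lemma isInverse_mapObj {X : D} {x y : X ⟶ B.arr} (h : B.IsInverse x y) :
    (B.mapObj R).IsInverse (R.map x) (R.map y) := by
  obtain ⟨h₁, h₂, h₃, h₄⟩ := h
  refine ⟨?_, ?_, ?_, ?_⟩
  · simp only [mapObj, ← R.map_comp, h₁]
  · simp only [mapObj, ← R.map_comp, h₂]
  · rw [← mapObj_hcomp R B x y h₁, h₃]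
    simp [mapObj]
  · rw [← mapObj_hcomp R B y x h₂, h₄]
    simp [mapObj]

include adj in
/-- A functor `R` with a full comparison functor reflects the unique lifting of arrows. -/
lemma liftsArr_map_iff [R.Faithful] [(Monad.comparison adj).Full] (G : A ⟶ B) :
    LiftsArr ((map R).map G) ↔ LiftsArr G := by
  rw [liftsArr_map_def]
  constructor
  · intro h X a a' x hs ht
    -- A priori `g` lives only in `C`; it comes from `D` once it commutes with the algebra actions.
    obtain ⟨g, ⟨hg, hgs, hgt⟩, -⟩ := h (R.map a) (R.map a') (R.map x)
      (by simp only [← R.map_comp, hs]) (by simp only [← R.map_comp, ht])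
    -- The two sides of the algebra morphism equation agree after `R G.arr`, `R A.src` and `R
    -- A.tgt`, since these and their composites with `g` come from `D`, where the counit is natural.
    -- Uniqueness of lifts then yields the equation itself.
    have key {Y : D} (k : A.arr ⟶ Y) (l : X ⟶ Y) (hkl : g ≫ R.map k = R.map l) :
        (R.map (L.map g) ≫ R.map (adj.counit.app A.arr)) ≫ R.map k =
          (R.map (adj.counit.app X) ≫ g) ≫ R.map k := by
      have e₁ : adj.counit.app A.arr ≫ k = L.map (R.map k) ≫ adj.counit.app Y :=
        (adj.counit_naturality k).symm
      have e₂ : L.map (R.map l) ≫ adj.counit.app Y = adj.counit.app X ≫ l :=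
        adj.counit_naturality l
      rw [Category.assoc, Category.assoc, hkl, ← R.map_comp, ← R.map_comp, ← R.map_comp, e₁, ← e₂,
        ← hkl, L.map_comp, Category.assoc]
    have hext {Y : C} {p q : Y ⟶ R.obj A.arr} (h₁ : p ≫ R.map G.arr = q ≫ R.map G.arr)
        (h₂ : p ≫ R.map A.src = q ≫ R.map A.src) (h₃ : p ≫ R.map A.tgt = q ≫ R.map A.tgt) :
        p = q :=
      LiftsArr.hom_ext (F := (map R).map G) h h₁ h₂ h₃
    have hom : R.map (L.map g) ≫ R.map (adj.counit.app A.arr) = R.map (adj.counit.app X) ≫ g :=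
      hext (key G.arr x hg) (key A.src a hgs) (key A.tgt a' hgt)
    let g' : (Monad.comparison adj).obj X ⟶ (Monad.comparison adj).obj A.arr := ⟨g, hom⟩
    obtain ⟨f, hf⟩ := (Monad.comparison adj).map_surjective g'
    obtain rfl : R.map f = g := congrArg Monad.Algebra.Hom.f hf
    simp only [← R.map_comp, R.map_injective.eq_iff] at hg hgs hgt
    refine ⟨f, ⟨hg, hgs, hgt⟩, ?_⟩
    rintro f' ⟨h₁, h₂, h₃⟩
    apply R.map_injective
    apply hext
    · simp only [← R.map_comp, hg, h₁]
    · simp only [← R.map_comp, hgs, h₂]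
    · simp only [← R.map_comp, hgt, h₃]
  · intro h X a a' x hs ht
    have hs' : (adj.homEquiv X B.arr).symm x ≫ B.src = (adj.homEquiv X A.obj).symm a ≫ G.obj := by
      rw [← adj.homEquiv_naturality_right_symm, ← adj.homEquiv_naturality_right_symm, hs]
    have ht' : (adj.homEquiv X B.arr).symm x ≫ B.tgt = (adj.homEquiv X A.obj).symm a' ≫ G.obj := by
      rw [← adj.homEquiv_naturality_right_symm, ← adj.homEquiv_naturality_right_symm, ht]
    obtain ⟨g, ⟨hg, hgs, hgt⟩, -⟩ := h _ _ _ hs' ht'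
    refine ⟨adj.homEquiv X A.arr g, ⟨?_, ?_, ?_⟩, ?_⟩
    · rw [← adj.homEquiv_naturality_right, hg, Equiv.apply_symm_apply]
    · rw [← adj.homEquiv_naturality_right, hgs, Equiv.apply_symm_apply]
    · rw [← adj.homEquiv_naturality_right, hgt, Equiv.apply_symm_apply]
    · rintro y ⟨hy, hys, hyt⟩
      rw [← Equiv.symm_apply_eq]
      apply h.hom_ext
      · rw [hg, ← adj.homEquiv_naturality_right_symm, hy]
      · rw [hgs, ← adj.homEquiv_naturality_right_symm, hys]
      · rw [hgt, ← adj.homEquiv_naturality_right_symm, hyt]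

end

variable [HasFiniteLimits D] {A B : InternalCat D}

include adj in
-- `C` is not assumed to have products, so `iso(R B)₁` is not formed; by transposition `R (iso(B)₁)`
-- plays its role.
lemma exists_map_isoLift {X : C} {x y : X ⟶ R.obj B.arr} (h : (B.mapObj R).IsInverse x y) :
    ∃ k : X ⟶ R.obj B.isoArr, k ≫ R.map B.isoι = x := by
  obtain ⟨k, hk, -⟩ := B.exists_isoLift (isInverse_homEquiv_symm adj h)
  refine ⟨adj.homEquiv _ _ k, ?_⟩
  rw [← adj.homEquiv_naturality_right, hk, Equiv.apply_symm_apply]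

lemma isInverse_map_isoι {X : C} (k : X ⟶ R.obj B.isoArr) {x : X ⟶ R.obj B.arr}
    (hx : k ≫ R.map B.isoι = x) : ∃ y : X ⟶ R.obj B.arr, (B.mapObj R).IsInverse x y := by
  subst hx
  exact ⟨_, (isInverse_mapObj (R := R) B.isInverse_iso).precomp k⟩

include adj in
lemma exists_map_pathObjLift (G : A ⟶ B) {X : C} {x y : X ⟶ R.obj B.arr} {a : X ⟶ R.obj A.obj}
    (h : (B.mapObj R).IsInverse x y) (ht : x ≫ R.map B.tgt = a ≫ R.map G.obj) :
    ∃ k : X ⟶ R.obj (pathObj G),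
      k ≫ R.map (pathFst G) ≫ R.map B.isoι = x ∧ k ≫ R.map (pathSnd G) = a := by
  obtain ⟨l, rfl⟩ := exists_map_isoLift adj h
  have hP := (isPullback_pathObj G).map R
  refine ⟨hP.lift l a (by simpa using ht), ?_, hP.lift_snd _ _ _⟩
  rw [hP.lift_fst_assoc]

include adj in
-- The generic object is the identity of `R B₀`: reaching it gives the section, and precomposing the
-- section with `b` reaches any other `b`.
lemma reachesObj_map_iff (G : A ⟶ B) :
    ReachesObj ((map R).map G) ↔ ∃ s, s ≫ R.map (pathSrc G) = 𝟙 (R.obj B.obj) := by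
  rw [reachesObj_map_def, pathSrc_eq]
  constructor
  · intro h
    obtain ⟨a, x, y, hi, hs, ht⟩ := h (𝟙 (R.obj B.obj))
    obtain ⟨k, rfl, -⟩ := exists_map_pathObjLift adj G hi ht
    exact ⟨k, by simpa using hs⟩
  · rintro ⟨s, hs⟩ X b
    have hw := (isPullback_pathObj G).w
    obtain ⟨y, hy⟩ := isInverse_map_isoι (b ≫ s ≫ R.map (pathFst G)) rfl
    refine ⟨b ≫ s ≫ R.map (pathSnd G), _, y, hy, ?_, ?_⟩
    · simp only [Category.assoc, ← R.map_comp, hs, Category.comp_id]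
    · simp only [Category.assoc, ← R.map_comp, hw]

include adj in
-- A lifting problem at stage `X` is a morphism from `X` to `R (P_G)₀`. The generic problem is the
-- identity, a solution of it is a section, and all others follow by precomposition.
lemma liftsIso_map_iff (G : A ⟶ B) :
    LiftsIso ((map R).map G) ↔ ∃ s, s ≫ R.map (pathLift G) = 𝟙 (R.obj (pathObj G)) := by
  rw [liftsIso_map_def]
  have hP := (isPullback_pathObj G).map R
  have hw := (isPullback_pathObj G).w
  constructor
  · intro h
    obtain ⟨y', hy'⟩ := isInverse_map_isoι (R.map (pathFst G)) rfl
    obtain ⟨x, y, hi, ht, hx⟩ := h (R.map (pathSnd G)) _ y' hy'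
      (by simp only [Category.assoc, ← R.map_comp, hw])
    obtain ⟨k, rfl⟩ := exists_map_isoLift adj hi
    refine ⟨k, hP.hom_ext ?_ ?_⟩
    -- `R` preserves pullbacks, hence monomorphisms, so invertible arrows may be compared in `R B₁`.
    · rw [← cancel_mono (R.map B.isoι)]
      rw [Category.assoc, Category.assoc, ← R.map_comp_assoc, pathLift_fst, ← R.map_comp, isoMap_ι,
        Category.id_comp, R.map_comp, ← Category.assoc, hx]
    · simpa only [Category.assoc, ← R.map_comp, pathLift_snd, Category.id_comp] using ht
  · rintro ⟨s, hs⟩ X a x y hi ht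
    obtain ⟨k, rfl, rfl⟩ := exists_map_pathObjLift adj G hi ht
    obtain ⟨y', hy'⟩ := isInverse_map_isoι (k ≫ s) rfl
    refine ⟨_, y', hy', ?_, ?_⟩
    · rw [Category.assoc, Category.assoc, ← R.map_comp, ← pathLift_snd, R.map_comp,
        reassoc_of% hs]
    · rw [Category.assoc, Category.assoc, ← R.map_comp, ← isoMap_ι, ← pathLift_fst, R.map_comp,
        R.map_comp, Category.assoc, reassoc_of% hs]

end adjunction

lemma hcomp_fst_snd {C : Type u} [Category.{v} C] (B : InternalCat C) :
    B.hcomp B.fst B.snd B.isPullback.w = B.mul := by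
  have : B.isPullback.lift B.fst B.snd B.isPullback.w = 𝟙 _ := by
    apply B.isPullback.hom_ext <;> simp
  rw [hcomp, this, Category.id_comp]

lemma isIso_of_components {C : Type u} [Category.{v} C] {A B : InternalCat C} (F : A ⟶ B)
    [IsIso F.obj] [IsIso F.arr] : IsIso F := by
  refine ⟨{ obj := inv F.obj, arr := inv F.arr, arr_src := ?_, arr_tgt := ?_, unit_arr := ?_,
            mul_arr := ?_ }, InternalCat.hom_ext ?_ ?_, InternalCat.hom_ext ?_ ?_⟩
  · rw [IsIso.inv_comp_eq, ← Category.assoc, IsIso.eq_comp_inv, F.arr_src]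
  · rw [IsIso.inv_comp_eq, ← Category.assoc, IsIso.eq_comp_inv, F.arr_tgt]
  · rw [IsIso.comp_inv_eq, Category.assoc, F.unit_arr, IsIso.inv_hom_id_assoc]
  · rw [IsIso.comp_inv_eq, Hom.hcomp_arr]
    simp only [Category.assoc, IsIso.inv_hom_id, Category.comp_id, hcomp_fst_snd]
  all_goals simp

/-! ### Lifting an internal category along a faithful functor that reflects pullbacks. -/

section descend

variable {C : Type u} [Category.{v} C] {D : Type u'} [Category.{v'} D] {R : D ⥤ C}

/-- The data for lifting an internal category along a functor `R`, up to isomorphism. -/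
structure LiftData (R : D ⥤ C) (A : InternalCat C) where
  obj : D
  arr : D
  pairs : D
  objIso : R.obj obj ≅ A.obj
  arrIso : R.obj arr ≅ A.arr
  pairsIso : R.obj pairs ≅ A.pairs
  src : arr ⟶ obj
  tgt : arr ⟶ obj
  unit : obj ⟶ arr
  fst : pairs ⟶ arr
  snd : pairs ⟶ arr
  mul : pairs ⟶ arr
  map_src : R.map src ≫ objIso.hom = arrIso.hom ≫ A.src
  map_tgt : R.map tgt ≫ objIso.hom = arrIso.hom ≫ A.tgt
  map_unit : R.map unit ≫ arrIso.hom = objIso.hom ≫ A.unit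
  map_fst : R.map fst ≫ arrIso.hom = pairsIso.hom ≫ A.fst
  map_snd : R.map snd ≫ arrIso.hom = pairsIso.hom ≫ A.snd
  map_mul : R.map mul ≫ arrIso.hom = pairsIso.hom ≫ A.mul

namespace LiftData

variable {A : InternalCat C} (P : LiftData R A)

lemma obj_hom_ext [R.Faithful] {X : D} {x y : X ⟶ P.obj}
    (h : R.map x ≫ P.objIso.hom = R.map y ≫ P.objIso.hom) : x = y :=
  R.map_injective ((cancel_mono _).1 h)

lemma arr_hom_ext [R.Faithful] {X : D} {x y : X ⟶ P.arr}
    (h : R.map x ≫ P.arrIso.hom = R.map y ≫ P.arrIso.hom) : x = y :=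
  R.map_injective ((cancel_mono _).1 h)

/-- The image of the square under `R` is isomorphic to the pullback of composable pairs of `A`, and
`R` reflects pullbacks. -/
lemma isPullback [R.Faithful] [ReflectsLimitsOfShape WalkingCospan R] :
    IsPullback P.fst P.snd P.tgt P.src := by
  have w : P.fst ≫ P.tgt = P.snd ≫ P.src := by
    apply R.map_injective
    rw [← cancel_mono P.objIso.hom]
    simp only [R.map_comp, Category.assoc, P.map_tgt, P.map_src,
      reassoc_of% P.map_fst, reassoc_of% P.map_snd, A.isPullback.w]
  refine IsPullback.of_map R w (IsPullback.of_iso A.isPullback P.pairsIso.symm P.arrIso.symm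
    P.arrIso.symm P.objIso.symm ?_ ?_ ?_ ?_)
  · rw [Iso.symm_hom, Iso.symm_hom, Iso.comp_inv_eq, Category.assoc, P.map_fst,
      Iso.inv_hom_id_assoc]
  · rw [Iso.symm_hom, Iso.symm_hom, Iso.comp_inv_eq, Category.assoc, P.map_snd,
      Iso.inv_hom_id_assoc]
  · rw [Iso.symm_hom, Iso.symm_hom, Iso.comp_inv_eq, Category.assoc, P.map_tgt,
      Iso.inv_hom_id_assoc]
  · rw [Iso.symm_hom, Iso.symm_hom, Iso.comp_inv_eq, Category.assoc, P.map_src,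
      Iso.inv_hom_id_assoc]

section

variable [R.Faithful] [ReflectsLimitsOfShape WalkingCospan R]

lemma map_lift_mul {X : D} (x y : X ⟶ P.arr) (h : x ≫ P.tgt = y ≫ P.src) :
    R.map (P.isPullback.lift x y h ≫ P.mul) ≫ P.arrIso.hom =
      A.hcomp (R.map x ≫ P.arrIso.hom) (R.map y ≫ P.arrIso.hom) (by
        simp only [Category.assoc, ← map_tgt, ← map_src, ← R.map_comp_assoc, h]) := by
  rw [R.map_comp, Category.assoc, P.map_mul, ← Category.assoc]
  refine congrArg (fun t => t ≫ A.mul) ?_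
  apply A.isPullback.hom_ext
  · rw [IsPullback.lift_fst, Category.assoc, ← P.map_fst, ← R.map_comp_assoc, IsPullback.lift_fst]
  · rw [IsPullback.lift_snd, Category.assoc, ← P.map_snd, ← R.map_comp_assoc, IsPullback.lift_snd]

/-- The lifted internal category. -/
def lift : InternalCat D where
  obj := P.obj
  arr := P.arr
  pairs := P.pairs
  src := P.src
  tgt := P.tgt
  unit := P.unit
  fst := P.fst
  snd := P.snd
  isPullback := P.isPullback
  mul := P.mul
  -- Each law is checked after the faithful `R` and transport to `A`, where it is the law of `A`.
  unit_src := P.obj_hom_ext (by simp [P.map_src, reassoc_of% P.map_unit])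
  unit_tgt := P.obj_hom_ext (by simp [P.map_tgt, reassoc_of% P.map_unit])
  mul_src := P.obj_hom_ext (by
    simp [P.map_src, reassoc_of% P.map_mul, reassoc_of% P.map_fst, A.mul_src])
  mul_tgt := P.obj_hom_ext (by
    simp [P.map_tgt, reassoc_of% P.map_mul, reassoc_of% P.map_snd, A.mul_tgt])
  unit_mul := P.arr_hom_ext (by
    rw [map_lift_mul]
    simp only [R.map_comp, Category.assoc, P.map_unit, reassoc_of% P.map_src]
    simp only [← Category.assoc, unit_hcomp])
  mul_unit := P.arr_hom_ext (by
    rw [map_lift_mul]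
    simp only [R.map_comp, Category.assoc, P.map_unit, reassoc_of% P.map_tgt]
    simp only [← Category.assoc, hcomp_unit])
  mul_assoc x y z hxy hyz := P.arr_hom_ext (by
    have h₁ := congrArg (fun t => R.map t ≫ P.objIso.hom) hxy
    have h₂ := congrArg (fun t => R.map t ≫ P.objIso.hom) hyz
    simp only [R.map_comp, Category.assoc, P.map_src, P.map_tgt] at h₁ h₂
    simp only [map_lift_mul]
    rw [hcomp_assoc _ _ _ _ (by simpa using h₁) (by simpa using h₂)])

/-- The image under `R` of the lifted internal category is the original one. -/
def mapLift [HasPullbacks D] [PreservesLimitsOfShape WalkingCospan R] :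
    (map R).obj P.lift ⟶ A where
  obj := P.objIso.hom
  arr := P.arrIso.hom
  arr_src := P.map_src.symm
  arr_tgt := P.map_tgt.symm
  unit_arr := P.map_unit
  mul_arr := by
    refine P.map_mul.trans ((congrArg (fun t => t ≫ A.mul) ?_))
    apply A.isPullback.hom_ext
    · exact P.map_fst.symm.trans (IsPullback.lift_fst _ _ _ _).symm
    · exact P.map_snd.symm.trans (IsPullback.lift_snd _ _ _ _).symm

instance [HasPullbacks D] [PreservesLimitsOfShape WalkingCospan R] : IsIso P.mapLift :=
  have : IsIso P.mapLift.obj := inferInstanceAs (IsIso P.objIso.hom)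
  have : IsIso P.mapLift.arr := inferInstanceAs (IsIso P.arrIso.hom)
  isIso_of_components _

end

end LiftData

end descend

/-! ### Pullbacks of algebras, on a prescribed underlying pullback. -/

section pullback

variable {C : Type u} [Category.{v} C] {T : Monad C} {Q Q' Z : T.Algebra} (f : Q ⟶ Z) (g : Q' ⟶ Z)
  {X : C} {p : X ⟶ Q.A} {q : X ⟶ Q'.A} (h : IsPullback p q f.f g.f)

/-- The action on a pullback of algebras. -/
def pullbackAct : T.obj X ⟶ X :=
  h.lift (T.map p ≫ Q.a) (T.map q ≫ Q'.a) (by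
    rw [Category.assoc, Category.assoc, ← f.h, ← g.h, ← Functor.map_comp_assoc,
      ← Functor.map_comp_assoc, h.w])

lemma pullbackAct_fst : pullbackAct f g h ≫ p = T.map p ≫ Q.a := IsPullback.lift_fst _ _ _ _

lemma pullbackAct_snd : pullbackAct f g h ≫ q = T.map q ≫ Q'.a := IsPullback.lift_snd _ _ _ _

/-- The algebra structure on a pullback of algebras. -/
def pullbackAlgebra : T.Algebra where
  A := X
  a := pullbackAct f g h
  unit := by
    have h₁ := T.η.naturality p
    have h₂ := T.η.naturality q
    dsimp only [Functor.id_map, Functor.id_obj] at h₁ h₂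
    apply h.hom_ext
    · rw [Category.assoc, pullbackAct_fst, ← reassoc_of% h₁, Q.unit, Category.comp_id]
      exact (Category.id_comp p).symm
    · rw [Category.assoc, pullbackAct_snd, ← reassoc_of% h₂, Q'.unit, Category.comp_id]
      exact (Category.id_comp q).symm
  assoc := by
    have h₁ := T.μ.naturality p
    have h₂ := T.μ.naturality q
    dsimp only [Functor.comp_map, Functor.comp_obj] at h₁ h₂
    apply h.hom_ext
    · simp only [Category.assoc, pullbackAct_fst]
      rw [← reassoc_of% h₁, Q.assoc, ← Functor.map_comp_assoc, ← Functor.map_comp_assoc,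
        pullbackAct_fst]
    · simp only [Category.assoc, pullbackAct_snd]
      rw [← reassoc_of% h₂, Q'.assoc, ← Functor.map_comp_assoc, ← Functor.map_comp_assoc,
        pullbackAct_snd]

lemma pullbackAlgebra_fst : (pullbackAlgebra f g h).a ≫ p = T.map p ≫ Q.a :=
  pullbackAct_fst f g h

lemma pullbackAlgebra_snd : (pullbackAlgebra f g h).a ≫ q = T.map q ≫ Q'.a :=
  pullbackAct_snd f g h

end pullback

/-! ### Objects and morphisms corresponding to algebras under a monadic adjunction. -/

section preimage

variable {C : Type u} [Category.{v} C] {D : Type u'} [Category.{v'} D]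
  {L : C ⥤ D} {R : D ⥤ C} (adj : L ⊣ R)

lemma faithful_of_comparison [(Monad.comparison adj).Faithful] : R.Faithful :=
  Functor.Faithful.of_iso (Monad.comparisonForget adj)

include adj in
-- Monadic functors create limits, and creation includes reflection.
lemma reflectsPullbacks_of_comparison [(Monad.comparison adj).IsEquivalence] :
    ReflectsLimitsOfShape WalkingCospan R := by
  let _ : MonadicRightAdjoint R := ⟨L, adj, inferInstance⟩
  let _ := monadicCreatesLimits.{0, 0} R
  exact ⟨fun {K} => inferInstance⟩

variable {adj} [(Monad.comparison adj).IsEquivalence]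

/-- The chosen object of `D` corresponding to an algebra. -/
def algPre (Q : adj.toMonad.Algebra) : D := (Monad.comparison adj).objPreimage Q

/-- The isomorphism of algebras given by the chosen object of `D`. -/
def algPreAlgIso (Q : adj.toMonad.Algebra) : (Monad.comparison adj).obj (algPre Q) ≅ Q :=
  (Monad.comparison adj).objObjPreimageIso Q

/-- The underlying isomorphism of `algPreAlgIso`. -/
def algPreIso (Q : adj.toMonad.Algebra) : R.obj (algPre Q) ≅ Q.A :=
  adj.toMonad.forget.mapIso (algPreAlgIso Q)

lemma algPreIso_act (Q : adj.toMonad.Algebra) :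
    R.map (L.map (algPreIso Q).hom) ≫ Q.a =
      R.map (adj.counit.app (algPre Q)) ≫ (algPreIso Q).hom :=
  (algPreAlgIso Q).hom.h

/-- The morphism of `D` corresponding to a morphism of algebras. -/
def algPreMap {Q Q' : adj.toMonad.Algebra} (f : Q ⟶ Q') : algPre Q ⟶ algPre Q' :=
  (Monad.comparison adj).preimage ((algPreAlgIso Q).hom ≫ f ≫ (algPreAlgIso Q').inv)

lemma map_algPreMap {Q Q' : adj.toMonad.Algebra} (f : Q ⟶ Q') :
    R.map (algPreMap f) ≫ (algPreIso Q').hom = (algPreIso Q).hom ≫ f.f := by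
  have h : (Monad.comparison adj).map (algPreMap f) ≫ (algPreAlgIso Q').hom =
      (algPreAlgIso Q).hom ≫ f := by
    rw [algPreMap, Functor.map_preimage, Category.assoc, Category.assoc, Iso.inv_hom_id,
      Category.comp_id]
  exact congrArg Monad.Algebra.Hom.f h

end preimage

/-! ### Internal categories in algebras versus algebras in internal categories. -/

section comparison

variable {C : Type u} [Category.{v} C] {D : Type u'} [Category.{v'} D] [HasPullbacks C]
  [HasPullbacks D] {L : C ⥤ D} {R : D ⥤ C} (adj : L ⊣ R)
  [PreservesLimitsOfShape WalkingCospan R]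
  [PreservesLimitsOfShape WalkingCospan adj.toMonad.toFunctor]

instance [R.Faithful] : (comparison adj).Faithful where
  map_injective {A B F G} h := by
    have h' : (map R).map F = (map R).map G := congrArg Monad.Algebra.Hom.f h
    exact InternalCat.hom_ext (R.map_injective (congrArg Hom.obj h'))
      (R.map_injective (congrArg Hom.arr h'))

/-- Both components of a strict morphism are morphisms of `T`-algebras, so each comes from `D`; the
functor laws descend because `R` is faithful. -/
instance [R.Faithful] [(Monad.comparison adj).Full] : (comparison adj).Full where
  map_surjective {A B} f := by
    have h₀ : R.map (L.map f.f.obj) ≫ R.map (adj.counit.app B.obj) =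
      R.map (adj.counit.app A.obj) ≫ f.f.obj := congrArg Hom.obj f.h
    have h₁ : R.map (L.map f.f.arr) ≫ R.map (adj.counit.app B.arr) =
      R.map (adj.counit.app A.arr) ≫ f.f.arr := congrArg Hom.arr f.h
    let a₀ : (Monad.comparison adj).obj A.obj ⟶ (Monad.comparison adj).obj B.obj := ⟨f.f.obj, h₀⟩
    let a₁ : (Monad.comparison adj).obj A.arr ⟶ (Monad.comparison adj).obj B.arr := ⟨f.f.arr, h₁⟩
    obtain ⟨g₀, hg₀⟩ := (Monad.comparison adj).map_surjective a₀
    obtain ⟨g₁, hg₁⟩ := (Monad.comparison adj).map_surjective a₁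
    have hg₀ : R.map g₀ = f.f.obj := congrArg Monad.Algebra.Hom.f hg₀
    have hg₁ : R.map g₁ = f.f.arr := congrArg Monad.Algebra.Hom.f hg₁
    have hs : g₁ ≫ B.src = A.src ≫ g₀ := R.map_injective (by
      rw [R.map_comp, R.map_comp, hg₀, hg₁]; exact f.f.arr_src)
    have ht : g₁ ≫ B.tgt = A.tgt ≫ g₀ := R.map_injective (by
      rw [R.map_comp, R.map_comp, hg₀, hg₁]; exact f.f.arr_tgt)
    refine ⟨{ obj := g₀, arr := g₁, arr_src := hs, arr_tgt := ht, unit_arr := ?_, mul_arr := ?_ },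
      Monad.Algebra.Hom.ext (InternalCat.hom_ext hg₀ hg₁)⟩
    · apply R.map_injective
      rw [R.map_comp, R.map_comp, hg₀, hg₁]
      exact f.f.unit_arr
    · apply R.map_injective
      rw [mapObj_hcomp]
      simp only [R.map_comp, hg₁]
      exact f.f.mul_arr

variable {adj}

section algebra

variable (P : (mapMonad adj.toMonad).Algebra)

/-- The algebra of objects of an algebra in internal categories. -/
def algObj : adj.toMonad.Algebra where
  A := P.A.obj
  a := P.a.obj
  unit := congrArg Hom.obj P.unit
  assoc := congrArg Hom.obj P.assoc

/-- The algebra of arrows of an algebra in internal categories. -/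
def algArr : adj.toMonad.Algebra where
  A := P.A.arr
  a := P.a.arr
  unit := congrArg Hom.arr P.unit
  assoc := congrArg Hom.arr P.assoc

/-- The source as a morphism of algebras. -/
def algSrc : algArr P ⟶ algObj P := ⟨P.A.src, P.a.arr_src.symm⟩

/-- The target as a morphism of algebras. -/
def algTgt : algArr P ⟶ algObj P := ⟨P.A.tgt, P.a.arr_tgt.symm⟩

/-- The algebra of composable pairs of an algebra in internal categories. -/
def algPairs : adj.toMonad.Algebra :=
  -- The action on pairs is componentwise, so compatibility of `P.a` with composition is literally
  -- the statement that `P.A.mul` is a morphism of algebras.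
  pullbackAlgebra (algTgt P) (algSrc P) P.A.isPullback

/-- The unit as a morphism of algebras. -/
def algUnit : algObj P ⟶ algArr P := ⟨P.A.unit, P.a.unit_arr⟩

/-- The first projection as a morphism of algebras. -/
def algFst : algPairs P ⟶ algArr P :=
  ⟨P.A.fst, (pullbackAlgebra_fst (algTgt P) (algSrc P) P.A.isPullback).symm⟩

/-- The second projection as a morphism of algebras. -/
def algSnd : algPairs P ⟶ algArr P :=
  ⟨P.A.snd, (pullbackAlgebra_snd (algTgt P) (algSrc P) P.A.isPullback).symm⟩

/-- The composition as a morphism of algebras. -/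
def algMul : algPairs P ⟶ algArr P := ⟨P.A.mul, P.a.mul_arr⟩

variable [(Monad.comparison adj).IsEquivalence]

/-- The data for lifting an algebra in internal categories to an internal category. -/
def algLiftData : LiftData R P.A where
  obj := algPre (algObj P)
  arr := algPre (algArr P)
  pairs := algPre (algPairs P)
  objIso := algPreIso (algObj P)
  arrIso := algPreIso (algArr P)
  pairsIso := algPreIso (algPairs P)
  src := algPreMap (algSrc P)
  tgt := algPreMap (algTgt P)
  unit := algPreMap (algUnit P)
  fst := algPreMap (algFst P)
  snd := algPreMap (algSnd P)
  mul := algPreMap (algMul P)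
  map_src := map_algPreMap _
  map_tgt := map_algPreMap _
  map_unit := map_algPreMap _
  map_fst := map_algPreMap _
  map_snd := map_algPreMap _
  map_mul := map_algPreMap _

end algebra

variable (adj)

/-- If `R` is monadic, then internal categories in `D` are algebras for the induced monad on
internal categories in `C`. -/
lemma isEquivalence_comparison [(Monad.comparison adj).IsEquivalence] :
    (comparison adj).IsEquivalence := by
  have := faithful_of_comparison adj
  have := reflectsPullbacks_of_comparison adj
  refine { essSurj := ⟨fun P => ?_⟩ }
  let i : (map R).obj (algLiftData P).lift ≅ P.A := asIso (algLiftData P).mapLift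
  refine ⟨(algLiftData P).lift, ⟨Monad.Algebra.isoMk i ?_⟩⟩
  -- Compatibility with the actions is an equation of internal functors, so it may be checked
  -- separately on objects and on arrows.
  exact InternalCat.hom_ext (algPreIso_act (algObj P)) (algPreIso_act (algArr P))

end comparison

end

end InternalCat

/-! ### Categories are the algebras for the path monad -/

namespace CategoryTheory.Quiv

instance : Quiv.forget.{u, u}.Faithful where
  map_injective {C D F G} h := by
    apply Cat.Hom.ext
    have h' : F.toFunctor.toPrefunctor = G.toFunctor.toPrefunctor := h
    exact CategoryTheory.Functor.hext (fun a => Prefunctor.congr_obj h' a)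
      (fun a b f => GraphPullback.map_heq_of_eq h' f)

/-- The algebra morphism equation evaluated at the arrow `p` of the graph of paths. -/
lemma map_composePath {C D : Cat.{u, u}}
    (f : (Monad.comparison Quiv.adj.{u, u}).obj C ⟶ (Monad.comparison Quiv.adj.{u, u}).obj D)
    {a b : C} (p : Quiver.Path a b) :
    f.f.map (composePath (C := C) p) =
      composePath (C := D) (Prefunctor.mapPath (V := C) (W := D) f.f p) :=
  (eq_of_heq (GraphPullback.map_heq_of_eq f.h p)).symm

/-- Compatibility with composing paths, applied to paths of length zero and two, gives preservation
of identities and of composition. -/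
instance full_comparison : (Monad.comparison Quiv.adj.{u, u}).Full where
  map_surjective {C D} f :=
    ⟨Functor.toCatHom
      { obj := f.f.obj
        map := f.f.map
        map_id := fun a => map_composePath f (Quiver.Path.nil (a := (a : C)))
        map_comp := fun {a b c} (g : (a : C) ⟶ (b : C)) (h : (b : C) ⟶ (c : C)) => by
          have e₁ : composePath (g.toPath.cons h) = g ≫ h :=
            congrArg (fun t => t ≫ h) (Category.id_comp g)
          let o : C → D := f.f.obj
          let g' : o a ⟶ o b := f.f.map g
          let h' : o b ⟶ o c := f.f.map h
          have e₂ : composePath (g'.toPath.cons h') = g' ≫ h' :=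
            congrArg (fun t => t ≫ h') (Category.id_comp g')
          exact (congrArg f.f.map e₁.symm).trans
            ((map_composePath f (g.toPath.cons h)).trans e₂) }, rfl⟩

section action

variable {V : Type u} [Quiver.{u} V] (m : ∀ {v w : V}, Quiver.Path v w → (v ⟶ w))
  (hη : ∀ {v w : V} (e : v ⟶ w), m e.toPath = e)
  (hμ : ∀ {v w : V} (Q : Quiver.Path (V := Paths V) v w),
    m (composePath Q) =
      m (Prefunctor.mapPath (V := Paths V) (W := V) { obj := fun v => v, map := m } Q))

include hμ in
-- Associativity of the action, applied to the path of paths with the two entries `p` and `q`.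
lemma act_comp {v w x : V} (p : Quiver.Path v w) (q : Quiver.Path w x) :
    m (p.comp q) = m ((m p).toPath.cons (m q)) := by
  have h := hμ (Quiver.Path.cons (Quiver.Path.cons (V := Paths V) Quiver.Path.nil p) q)
  refine Eq.trans (congrArg _ ?_) h
  exact (congrArg (fun t => Quiver.Path.comp t q) (Quiver.Path.nil_comp p)).symm

/-- The category structure given by an action of paths on a graph. -/
abbrev categoryOfAct : Category.{u} V where
  id v := m (Quiver.Path.nil (a := v))
  comp f g := m (f.toPath.cons g)
  id_comp f := by
    have h := act_comp m hμ Quiver.Path.nil f.toPath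
    simpa only [Quiver.Path.nil_comp, hη] using h.symm
  comp_id f := by
    have h := act_comp m hμ f.toPath Quiver.Path.nil
    simpa only [Quiver.Path.comp_nil, hη] using h.symm
  assoc f g h := by
    have h₁ := act_comp m hμ (f.toPath.cons g) h.toPath
    have h₂ := act_comp m hμ f.toPath (g.toPath.cons h)
    simp only [hη] at h₁ h₂
    rw [← h₁, ← h₂]
    rfl

/-- The action is recovered from its values on paths of length zero and two by adding one edge at a
time. -/
lemma composePath_categoryOfAct {v w : V} (p : Quiver.Path v w) :
    letI := categoryOfAct m hη hμ
    composePath p = m p := by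
  let _ := categoryOfAct m hη hμ
  induction p with
  | nil => rfl
  | cons p e ih =>
    rw [composePath_cons, ih]
    have h := act_comp m hμ p e.toPath
    rw [hη] at h
    exact h.symm

end action

instance essSurj_comparison : (Monad.comparison Quiv.adj.{u, u}).EssSurj where
  mem_essImage P := by
    obtain ⟨V, ⟨obj, map⟩, hη, hμ⟩ := P
    -- The free category has the same vertices as the graph, so the unit law forces the action to be
    -- the identity on them.
    obtain rfl : obj = fun v => v := funext fun v => Prefunctor.congr_obj hη v
    have hη' {v w : V} (e : v ⟶ w) : map e.toPath = e :=
      eq_of_heq (GraphPullback.map_heq_of_eq hη e)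
    have hμ' {v w : V} (Q : Quiver.Path (V := Paths V) v w) : map (composePath (C := Paths V) Q) =
        map (Prefunctor.mapPath (V := Paths V) (W := V) { obj := fun v => v, map := map } Q) :=
      eq_of_heq (GraphPullback.map_heq_of_eq hμ Q)
    let _ : Category.{u} V := categoryOfAct map hη' hμ'
    refine ⟨Cat.of V, ⟨Monad.Algebra.isoMk (Iso.refl _) ?_⟩⟩
    refine GraphPullback.prefunctor_ext (fun _ => rfl) (fun {v w} p => heq_of_eq ?_)
    change map (Prefunctor.mapPath (𝟭q V) p) = composePath (C := V) p
    refine (congrArg (fun t => map t) (Prefunctor.mapPath_id (V := V) p)).trans ?_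
    exact (composePath_categoryOfAct map hη' hμ' p).symm

end CategoryTheory.Quiv

/-! ### Epimorphisms for the categorically surjective topology. -/

namespace InternalCat

/-- Epimorphisms of sheaves are the locally surjective maps, and local surjectivity can be tested
before sheafifying. For a map of representables it suffices to lift the generic section `𝟙 B`
locally, and the sieve on which it lifts is generated by `p`. -/
lemma isTopEpi_iff {C : Type u} [Category.{v} C] (J : GrothendieckTopology C) {E B : C}
    (p : E ⟶ B) : IsTopEpi J p ↔ Sieve.generate (Presieve.singleton p) ∈ J B := by
  rw [IsTopEpi, ← Sheaf.isLocallySurjective_iff_epi,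
    Presheaf.isLocallySurjective_presheafToSheaf_map_iff]
  constructor
  · intro h
    refine J.superset_covering ?_ (h.imageSieve_mem (U := B) (ULift.up (𝟙 B)))
    rintro X g ⟨⟨t⟩, ht⟩
    have ht : t ≫ p = g ≫ 𝟙 B := congrArg ULift.down ht
    exact ⟨E, t, p, ⟨⟩, by simpa using ht⟩
  · intro h
    refine ⟨fun {X} b => J.superset_covering ?_ (J.pullback_stable b.down h)⟩
    rintro Y g ⟨_, k, _, ⟨⟩, hk⟩
    exact ⟨ULift.up k, congrArg ULift.up hk⟩

end InternalCat

lemma USplit.of_fac {D E B : Cat.{u, u}} {F : D ⟶ B} {p : E ⟶ B} (k : D ⟶ E) (h : k ≫ p = F)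
    (hF : USplit F) : USplit p := by
  obtain ⟨q, hq⟩ := hF
  exact ⟨q ≫ Quiv.forget.map k, by rw [Category.assoc, ← Functor.map_comp, h, hq]⟩

/-- Objects are lifted by choice, then arrows one at a time by fullness. No coherence is needed,
since a morphism of non-reflexive graphs preserves neither identities nor composites. -/
lemma CategoricallySurjective.uSplit {D B : Cat.{u, u}} {F : D ⟶ B}
    (hF : CategoricallySurjective F) : USplit F := by
  obtain ⟨h, hF⟩ := hF
  choose o ho using h
  refine ⟨Prefunctor.mk (V := B) (W := D) o (fun {a b} f =>
    F.toFunctor.preimage (eqToHom (ho a) ≫ f ≫ eqToHom (ho b).symm)), ?_⟩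
  refine GraphPullback.prefunctor_ext ho (fun {a b} f => ?_)
  change F.toFunctor.map (F.toFunctor.preimage _) ≍ f
  rw [Functor.map_preimage]
  exact (eqToHom_comp_heq _ _).trans (comp_eqToHom_heq _ _)

/-- The counit is the identity on objects, and every arrow is the composite of the path of length
one that it forms. -/
lemma catSurj_counit (B : Cat.{u, u}) : CategoricallySurjective (Quiv.adj.{u, u}.counit.app B) :=
  ⟨fun b => ⟨b, rfl⟩, ⟨fun f => ⟨Quiver.Hom.toPath (V := B) f, composePath_toPath (C := B) f⟩⟩⟩

lemma generate_mem_catSurjTopology_iff {E B : Cat.{u, u}} (p : E ⟶ B) :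
    Sieve.generate (Presieve.singleton p) ∈ catSurjTopology B ↔ USplit p := by
  constructor
  · rintro ⟨D, F, hF, ⟨_, k, _, ⟨⟩, hk⟩⟩
    exact .of_fac k hk hF.uSplit
  · rintro ⟨q, hq⟩
    -- The transpose of the section `q` is a functor from the free category on `U B` whose composite
    -- with `p` is the counit.
    refine ⟨_, Quiv.adj.{u, u}.counit.app B, catSurj_counit B, E,
      (Quiv.adj.{u, u}.homEquiv _ _).symm q, p, ⟨⟩, ?_⟩
    rw [← Quiv.adj.{u, u}.homEquiv_naturality_right_symm, hq, Adjunction.homEquiv_symm_id]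

namespace CategoryTheory.MorphismProperty

/-- Left lifting properties are transported along equivalences of categories. -/
lemma llp_inverseImage {C : Type u} [Category.{v} C] {D : Type u'} [Category.{v'} D] (F : C ⥤ D)
    [F.IsEquivalence] (W : MorphismProperty D) [W.RespectsIso] :
    W.llp.inverseImage F = (W.inverseImage F).llp := by
  let adj := F.asEquivalence.toAdjunction
  ext A B i
  constructor
  · intro h X Y p hp
    -- Lifting problems move across the adjunction between `F` and its inverse; the unit identifies
    -- the image of `F p` under the inverse with `p`.
    have h₁ := (adj.hasLiftingProperty_iff i (F.map p)).1 (h _ hp)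
    exact (HasLiftingProperty.iff_of_arrow_iso_right i
      (CategoryTheory.Arrow.isoOfNatIso F.asEquivalence.unitIso
        (CategoryTheory.Arrow.mk p)).symm).1 h₁
  · intro h X Y p hp
    refine (adj.hasLiftingProperty_iff i p).2 (h _ ?_)
    -- The inverse image of `p` maps under `F` to an arrow isomorphic to `p`, which is in `W` by
    -- invariance.
    exact (W.arrow_mk_iso_iff (CategoryTheory.Arrow.isoOfNatIso F.asEquivalence.counitIso
      (CategoryTheory.Arrow.mk p))).2 hp

end CategoryTheory.MorphismProperty

theorem mainTheorem7 :
    DblCat.toAlg.{u}.IsEquivalence ∧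
      DblCat.algWE.{u}.inverseImage DblCat.toAlg = InternalCat.topWE catSurjTopology ∧
      DblCat.algFib.{u}.inverseImage DblCat.toAlg = InternalCat.topFib catSurjTopology ∧
      DblCat.algCof.{u}.inverseImage DblCat.toAlg = InternalCat.topCof catSurjTopology ∧
      ∀ ⦃A B : DblCat.{u}⦄ (G : A ⟶ B),
        (DblCat.algWE (DblCat.toAlg.map G) ↔
          InternalCat.FullyFaithful G ∧ USplit (InternalCat.pathSrc G)) ∧
        (DblCat.algFib (DblCat.toAlg.map G) ↔ USplit (InternalCat.pathLift G)) := by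
  -- The fields are filled by the instances for faithfulness, fullness and essential surjectivity.
  have h₀ : (Monad.comparison Quiv.adj.{u, u}).IsEquivalence := { }
  have h : DblCat.toAlg.{u}.IsEquivalence := InternalCat.isEquivalence_comparison Quiv.adj.{u, u}
  have hW {A B : DblCat.{u}} (G : A ⟶ B) : DblCat.algWE (DblCat.toAlg.map G) ↔
      InternalCat.FullyFaithful G ∧ USplit (InternalCat.pathSrc G) := by
    refine (InternalCat.trivialWE_iff _).trans (and_congr ?_ ?_)
    · rw [InternalCat.fullyFaithful_iff]
      exact InternalCat.liftsArr_map_iff Quiv.adj.{u, u} G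
    · exact InternalCat.reachesObj_map_iff Quiv.adj.{u, u} G
  have hF {A B : DblCat.{u}} (G : A ⟶ B) : DblCat.algFib (DblCat.toAlg.map G) ↔
      USplit (InternalCat.pathLift G) :=
    (InternalCat.trivialFib_iff _).trans (InternalCat.liftsIso_map_iff Quiv.adj.{u, u} G)
  have hW' : DblCat.algWE.{u}.inverseImage DblCat.toAlg = InternalCat.topWE catSurjTopology := by
    ext A B G
    rw [MorphismProperty.inverseImage_iff, hW, InternalCat.topWE, InternalCat.isTopEpi_iff,
      generate_mem_catSurjTopology_iff]
  have hF' : DblCat.algFib.{u}.inverseImage DblCat.toAlg = InternalCat.topFib catSurjTopology := by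
    ext A B G
    rw [MorphismProperty.inverseImage_iff, hF, InternalCat.topFib, InternalCat.isTopEpi_iff,
      generate_mem_catSurjTopology_iff]
  refine ⟨h, hW', hF', ?_, fun A B G => ⟨hW G, hF G⟩⟩
  have : DblCat.algWE.{u}.RespectsIso :=
    inferInstanceAs (MorphismProperty.inverseImage _ _).RespectsIso
  have : DblCat.algFib.{u}.RespectsIso :=
    inferInstanceAs (MorphismProperty.inverseImage _ _).RespectsIso
  -- The acyclic fibrations correspond by the two previous identifications, hence so do their left
  -- lifting classes.
  rw [DblCat.algCof, MorphismProperty.llp_inverseImage, InternalCat.topCof, ← hW', ← hF']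
  rfl
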